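/- Let spacetime carry, in coordinates $(x^0,\boldsymbol x)=(ct,\boldsymbol x)$ with $r=|\boldsymbol x|$, the static, spherically symmetric metric $$ds^2=\mathcal A(r)\,(dx^0)^2-\frac{1}{\mathcal B(r)}\,\delta_{ij}\,dx^i dx^j ,$$ where, for $r>r_h=h\,m$ with $m=GM/c^2>0$ and a fixed $h>0$, the functions $\mathcal A$ and $1/\mathcal B$ are positive and given by convergent power series in $m/r$, with coefficients independent of $m$, $$\mathcal A(r)=1-\frac{2m}{r}+2\beta\frac{m^2}{r^2}+\cdots,\qquad \frac1{\mathcal B(r)}=1+2\gamma\frac mr+\frac32\,\epsilon\,\frac{m^2}{r^2}+\cdots .$$ Put $\kappa=\frac14\,[\,8(1+\gamma)-4\beta+3\epsilon\,]$. A null geodesic $\sigma\mapsto x(\sigma)$, $-\infty<\sigma\le\sigma_B$, lying in $r>r_h$, $\sigma$ being an affine parameter, is a quasi-Minkowskian light ray emitted at infinity in the direction of the unit vector $\boldsymbol N_e$ and received at $x_B=x(\sigma_B)$ if $$x^0=x_B^0+\sigma-\sigma_B+\sum_{n\ge1}G^nX^0_{(n)}(\sigma),\qquad \boldsymbol x=\boldsymbol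 x_B+(\sigma-\sigma_B)\boldsymbol N_e+\sum_{n\ge1}G^n\boldsymbol X_{(n)}(\sigma),$$ where the $X_{(n)}$ vanish at $\sigma_B$ and do not depend on $G$ (the same series gives a null geodesic in the exterior region of the corresponding metric for every smaller positive value of the gravitational constant), and if these rays are asymptotic, as $\sigma\to-\infty$, to straight lines parallel to $\boldsymbol N_e$. The impact parameter of a ray is the constant $b=|\boldsymbol x\times\widehat{\underline{\boldsymbol l}}|$, where $\widehat{\underline{\boldsymbol l}}=(l_i/l_0)$ and $l_\alpha=g_{\alpha\beta}\,dx^\beta/d\sigma$. The gravitational deflection of the ray relative to the static observer at $\boldsymbol x_B$ is $$\Delta\chi_B=\delta_{\mathcal E}(\boldsymbol N_e,-\boldsymbol n_B)-\delta_B,\qquad \boldsymbol n_B=\boldsymbol x_B/|\boldsymbol x_B| ,$$ where $\delta_{\mathcal E}$ is the Euclidean angle and $\delta_B$ is the angle, measured by this observer, between the ray and the ingoing radial null geodesic (emitted at infinity in the direction $-\boldsymbol n_B$) arriving at $\boldsymbol x_B$ at the same instant. Consider a null geodesic in the region $r>r_h$ that comes from infinity and returns to infinity, and let $\boldsymbol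 x_P$ be its periapsis. Suppose that its portion up to $\boldsymbol x_P$ is a quasi-Minkowskian light ray emitted at infinity in the direction $\boldsymbol N_e$, and let $b$ be its impact parameter. Its total gravitational deflection is $\Delta\chi=2\,\Delta\chi_P$. There are constants $K,C>0$, depending only on $h$ and on the coefficients of the two power series, such that, whenever $b\ge K\,r_h$, $$\left|\,\Delta\chi-\frac{2(1+\gamma)GM}{c^2b}-\frac{\kappa\pi G^2M^2}{c^4b^2}\right|\le C\,\frac{G^3M^3}{c^6b^3}.$$ Moreover, for such a ray the direction of propagation has a limit $\boldsymbol N_o$ as the ray returns to infinity, and the Euclidean angle between $\boldsymbol N_e$ and $\boldsymbol N_o$ is $|\Delta\chi|$. -/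

import Mathlib

open Filter Topology Set

noncomputable section

namespace PPM

/-- Ordered triples, with the Euclidean scalar product and norm. -/
abbrev Triple := EuclideanSpace ℝ (Fin 3)

/-- The global quasi-Cartesian chart `(x⁰, 𝐱)`; also the coordinates of tangent vectors. -/
abbrev Spacetime := ℝ × Triple

/-- A metric in the chart: `g x v w` is the scalar product at `x` of tangent vectors `v`, `w`. -/
abbrev MetricField := Spacetime → Spacetime → Spacetime → ℝ

/-- `ds² = 𝒜(r) (dx⁰)² - (1 / ℬ(r)) δᵢⱼ dxⁱ dxʲ` with `r = |𝐱|`. -/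
def isotropicMetric (A B : ℝ → ℝ) : MetricField := fun x v w =>
  A ‖x.2‖ * (v.1 * w.1) - 1 / B ‖x.2‖ * inner ℝ v.2 w.2

/-- The data of the potentials in the exterior region `r > r_h = h m`: coefficients (not depending
on `m`) of convergent expansions in powers of `m / r`,
`𝒜 = 1 - 2 (m/r) + 2 β (m/r)² + ⋯` and `1/ℬ = 1 + 2 γ (m/r) + (3/2) ε (m/r)² + ⋯`,
both sums being positive in that region (the metric is regular there). -/
structure Potentials (β γ ε : ℝ) where
  /-- the coefficients of `𝒜` -/
  a : ℕ → ℝ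
  /-- the coefficients of `1 / ℬ` -/
  d : ℕ → ℝ
  /-- the ratio `r_h / m` -/
  h : ℝ
  h_pos : 0 < h
  a_zero : a 0 = 1
  a_one : a 1 = -2
  a_two : a 2 = 2 * β
  d_zero : d 0 = 1
  d_one : d 1 = 2 * γ
  d_two : d 2 = 3 / 2 * ε
  summable_a : ∀ u : ℝ, 0 < u → u < 1 / h → Summable fun n => a n * u ^ n
  summable_d : ∀ u : ℝ, 0 < u → u < 1 / h → Summable fun n => d n * u ^ n
  a_pos : ∀ u : ℝ, 0 < u → u < 1 / h → 0 < ∑' n, a n * u ^ n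
  d_pos : ∀ u : ℝ, 0 < u → u < 1 / h → 0 < ∑' n, d n * u ^ n

namespace Potentials

variable {β γ ε : ℝ}

/-- The potential `𝒜(r)` of a body with `G M / c² = m`. -/
def potA (P : Potentials β γ ε) (m r : ℝ) : ℝ := ∑' n, P.a n * (m / r) ^ n

/-- The potential `ℬ(r)` of a body with `G M / c² = m`. -/
def potB (P : Potentials β γ ε) (m r : ℝ) : ℝ := 1 / ∑' n, P.d n * (m / r) ^ n

/-- The metric of a body with `G M / c² = m`. -/
def metric (P : Potentials β γ ε) (m : ℝ) : MetricField :=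
  isotropicMetric (P.potA m) (P.potB m)

/-- The radius `r_h`. -/
def rh (P : Potentials β γ ε) (m : ℝ) : ℝ := P.h * m

end Potentials

/-- `x`, restricted to the parameter set `s`, is a future-directed null geodesic of `g` with affine
parameter. The geodesic equation is `d l_α / dσ = (1/2) ∂_α g_{μν} (dx^μ/dσ) (dx^ν/dσ)`, where
`l_α = g_{αβ} dx^β/dσ`, contracted with an arbitrary constant `w^α`. -/
structure IsLightRayOn (g : MetricField) (x : ℝ → Spacetime) (s : Set ℝ) : Prop where
  differentiable : DifferentiableOn ℝ x s
  geodesic : ∀ σ ∈ s, ∀ w : Spacetime,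
    HasDerivWithinAt (fun τ => g (x τ) (derivWithin x s τ) w)
      (1 / 2 * fderiv ℝ (fun y => g y (derivWithin x s σ) (derivWithin x s σ)) (x σ) w) s σ
  null : ∀ σ ∈ s, g (x σ) (derivWithin x s σ) (derivWithin x s σ) = 0
  future : ∀ σ ∈ s, 0 < (derivWithin x s σ).1

/-- The direction triple `(l_i / l_0)` of the tangent vector `l` at `x`. -/
def directionTriple (g : MetricField) (x l : Spacetime) : Triple :=
  WithLp.toLp 2 fun i => g x l (0, EuclideanSpace.single i 1) / g x l (1, 0)

/-- The angular momentum `𝐋 = - 𝐱 × (l_i / l_0)` of a ray with tangent vector `l` at `x`. -/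
def angularMomentum (g : MetricField) (x l : Spacetime) : Triple :=
  WithLp.toLp 2 (-crossProduct x.2.ofLp (directionTriple g x l).ofLp)

/-- The impact parameter `|𝐋|` of a ray with tangent vector `l` at `x`. -/
def impactParameter (g : MetricField) (x l : Spacetime) : ℝ := ‖angularMomentum g x l‖

/-- The unit 4-velocity at `x` of an observer at rest in the chart. -/
def staticVelocity (g : MetricField) (x : Spacetime) : Spacetime :=
  (1 / Real.sqrt (g x (1, 0) (1, 0))) • ((1, 0) : Spacetime)

/-- The unit spacelike vector giving the direction of propagation of a ray with tangent vector `l`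
at `x` relative to the static observer at `x`. -/
def observedDirection (g : MetricField) (x l : Spacetime) : Spacetime :=
  (1 / g x (staticVelocity g x) l) • l - staticVelocity g x

/-- The angle in `[0, π]`, measured by the static observer at `x`, between two rays with tangent
vectors `l` and `l'` at `x`; the metric has signature `+ - - -`. -/
def observedAngle (g : MetricField) (x l l' : Spacetime) : ℝ :=
  Real.arccos (-g x (observedDirection g x l) (observedDirection g x l'))

/-- The gravitational contribution to the angular separation at `x` of two rays with tangent vectors
`l`, `l'` at `x` which were emitted at infinity in the directions `N`, `N'`. -/
def gravSeparation (g : MetricField) (x l l' : Spacetime) (N N' : Triple) : ℝ :=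
  observedAngle g x l l' - InnerProductGeometry.angle N N'

/-- As `σ → -∞`, the path `x` comes from infinity and is asymptotic to a straight line that is
parallel to `N` and described in the direction of `N`. -/
def ComesFromInfinity (x : ℝ → Spacetime) (N : Triple) : Prop :=
  Tendsto (fun σ => inner ℝ N (x σ).2) atBot atBot ∧
    ∃ q : Triple, Tendsto (fun σ => (x σ).2 - inner ℝ N (x σ).2 • N) atBot (𝓝 q)

/-- For the gravitational constant `G`, the path `x` on `(-∞, σB]` is a quasi-Minkowskian light ray
emitted at infinity in the direction `N` and received at `x σB`. The coefficients `X n` of the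
powers `G ^ (n + 1)` do not depend on the gravitational constant: the series, with the same
coefficients, gives a light ray with the same `N` and the same point of reception for each value
`G'` of the gravitational constant up to `G`. -/
def IsQuasiMinkowskianFromInfinity {β γ ε : ℝ} (P : Potentials β γ ε) (c M G : ℝ)
    (N : Triple) (σB : ℝ) (x : ℝ → Spacetime) : Prop :=
  ‖N‖ = 1 ∧
  ∃ (X : ℕ → ℝ → Spacetime) (z : ℝ → ℝ → Spacetime),
    (∀ n, X n σB = 0) ∧
    (∀ σ ≤ σB, z G σ = x σ) ∧
    ∀ G', 0 < G' → G' ≤ G →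
      (∀ σ ≤ σB, HasSum (fun n => G' ^ (n + 1) • X n σ)
        (z G' σ - (x σB + (σ - σB) • ((1, N) : Spacetime)))) ∧
      IsLightRayOn (P.metric (G' * M / c ^ 2)) (z G') (Iic σB) ∧
      (∀ σ ≤ σB, P.rh (G' * M / c ^ 2) < ‖(z G' σ).2‖) ∧
      ComesFromInfinity (z G') N

/-- The path `y` on `(-∞, τ]` is an ingoing radial null geodesic in the region `r > rh`, which comes
from infinity along the half-line in the direction of the unit triple `n`; it is thus emitted at
infinity in the direction `-n`. -/
structure IsIngoingRadialRay (g : MetricField) (rh : ℝ) (n : Triple) (τ : ℝ)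
    (y : ℝ → Spacetime) : Prop where
  unit : ‖n‖ = 1
  lightRay : IsLightRayOn g y (Iic τ)
  exterior : ∀ σ ≤ τ, rh < ‖(y σ).2‖
  radial : ∀ σ ≤ τ, (y σ).2 = ‖(y σ).2‖ • n
  ingoing : ∀ σ ≤ τ, ∃ k : ℝ, 0 < k ∧ (derivWithin y (Iic τ) σ).2 = -(k • n)
  fromInfinity : Tendsto (fun σ => ‖(y σ).2‖) atBot atTop

/-- The gravitational deflection, relative to the static observer at `x`, of a ray emitted at
infinity in the direction `N` and having the tangent vector `l` at `x`: minus the gravitational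
contribution to its angular separation from the ingoing radial ray which has the tangent vector `k`
at `x` and is emitted at infinity in the direction `-n`. -/
def deflectionAt (g : MetricField) (x l k : Spacetime) (N n : Triple) : ℝ :=
  -gravSeparation g x l k N (-n)

/-- The parameter `κ = (8 (1 + γ) - 4 β + 3 ε) / 4`. -/
def kappa (β γ ε : ℝ) : ℝ := 1 / 4 * (8 * (1 + γ) - 4 * β + 3 * ε)

end PPM

end

open PPM

/-! An isotropic static metric bends light as a medium of refractive index `n = √(1/(𝒜ℬ))`, a
function of `u = m/r`. In terms of `p = -(l_i/l_0)`, a null geodesic satisfies `X' = λ p`, while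
`p'` is radial (`Potentials.exists_optical`). With `s = ⟪X, p⟫`, Bouguer's invariant reads `r²n² -
s² = b²`.

Put `ψ = arctan (s/b)` and let `q = u d(log n)/du`. The ray equations give `ds = λ n² (1 - q) dσ`
and, for the polar angle, `dθ = λ b / r² dσ`, hence `dθ/dψ = 1/(1 - q)`. The invariant also gives
`cos ψ = b/(r n)`, that is, `u/n(u) = (m/b) cos ψ`. Since `u ↦ u/n(u)` is invertible near `0`, `1/(1
- q)` is `1 + Q((m/b) cos ψ)` for one function `Q`, depending only on the potentials, with `Q(v) =
(1 + γ) v + 2κ v² + O(v³)` (`Potentials.exists_bending`). In this variable the orbit integral has no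
singularity at the periapsis, so the expansion integrates term by term (`exists_polarAngle`).

The periapsis is `ψ = 0` and the two ends are `ψ = ±π/2`. The angle swept on each side is `φ = π/2 +
(1 + γ) m/b + κπ (m/b)²/2 + O((m/b)³)`, the same on both sides because `cos` is even. At the
periapsis the static observer sees the ray orthogonal to the radial one, and `φ` is the Euclidean
angle between `Ne` and the inward radial direction. Hence `Δχ = 2φ - π`, and the asymptotic
directions make the angle `|2φ - π|`. -/

noncomputable section
namespace PPM

open Asymptotics

/-! ### Power series known to converge at small positive arguments -/

section PowerSeries

/-- The sum of the power series with coefficients `a`. -/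
def seriesSum (a : ℕ → ℝ) (u : ℝ) : ℝ := ∑' n, a n * u ^ n

/-- Convergence at a positive `u` forces the terms to tend to `0`, which bounds the radius below.
One-sided convergence thus yields analyticity around `u = 0`, where two-sided neighbourhoods are
needed later. -/
theorem le_radius_ofScalars {a : ℕ → ℝ} {ρ : ℝ}
    (h : ∀ u : ℝ, 0 < u → u < ρ → Summable fun n => a n * u ^ n) :
    ENNReal.ofReal ρ ≤ (FormalMultilinearSeries.ofScalars ℝ a).radius := by
  refine ENNReal.le_of_forall_nnreal_lt fun r hr => ?_
  rcases eq_or_ne r 0 with rfl | hr0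
  · simp
  have hr1 : (r : ℝ) < ρ := by
    rw [← ENNReal.ofReal_coe_nnreal] at hr
    exact (ENNReal.ofReal_lt_ofReal_iff_of_nonneg r.2).1 hr
  have hs := h r (by positivity) hr1
  refine FormalMultilinearSeries.le_radius_of_tendsto (l := 0) _ ?_
  have := hs.tendsto_atTop_zero.norm
  simpa [FormalMultilinearSeries.ofScalars_norm, norm_mul] using this

theorem hasFPowerSeriesOnBall_seriesSum {a : ℕ → ℝ} {ρ : ℝ} (hρ : 0 < ρ)
    (h : ∀ u : ℝ, 0 < u → u < ρ → Summable fun n => a n * u ^ n) :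
    HasFPowerSeriesOnBall (seriesSum a) (FormalMultilinearSeries.ofScalars ℝ a) 0
      (ENNReal.ofReal ρ) := by
  have hr := le_radius_ofScalars h
  have hpos : 0 < ENNReal.ofReal ρ := ENNReal.ofReal_pos.2 hρ
  have := ((FormalMultilinearSeries.ofScalars ℝ a).hasFPowerSeriesOnBall
    (hpos.trans_le hr)).mono hpos hr
  convert! this using 1
  funext u
  simp [seriesSum, FormalMultilinearSeries.sum, mul_comm]

theorem analyticAt_seriesSum {a : ℕ → ℝ} {ρ : ℝ} (hρ : 0 < ρ)
    (h : ∀ u : ℝ, 0 < u → u < ρ → Summable fun n => a n * u ^ n) {u : ℝ} (hu : |u| < ρ) :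
    AnalyticAt ℝ (seriesSum a) u := by
  refine (hasFPowerSeriesOnBall_seriesSum hρ h).analyticAt_of_mem ?_
  rw [Metric.mem_eball, edist_dist, dist_zero_right, Real.norm_eq_abs]
  exact (ENNReal.ofReal_lt_ofReal_iff hρ).2 hu

theorem summable_of_abs_lt {a : ℕ → ℝ} {ρ : ℝ} (hρ : 0 < ρ)
    (h : ∀ u : ℝ, 0 < u → u < ρ → Summable fun n => a n * u ^ n) {u : ℝ} (hu : |u| < ρ) :
    Summable fun n => a n * u ^ n := by
  have := (hasFPowerSeriesOnBall_seriesSum hρ h).hasSum (y := u) (by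
    rw [Metric.mem_eball, edist_dist, dist_zero_right, Real.norm_eq_abs]
    exact (ENNReal.ofReal_lt_ofReal_iff hρ).2 hu)
  simpa [mul_comm] using this.summable

theorem summable_shift {a : ℕ → ℝ} {ρ : ℝ}
    (h : ∀ u : ℝ, 0 < u → u < ρ → Summable fun n => a n * u ^ n) (k : ℕ) :
    ∀ u : ℝ, 0 < u → u < ρ → Summable fun n => a (n + k) * u ^ n := by
  intro u hu hu'
  have := ((summable_nat_add_iff k).2 (h u hu hu')).mul_right (u ^ k)⁻¹
  refine this.congr fun n => ?_
  rw [pow_add]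
  field_simp

theorem seriesSum_eq_add_pow_mul {a : ℕ → ℝ} {ρ : ℝ} (hρ : 0 < ρ)
    (h : ∀ u : ℝ, 0 < u → u < ρ → Summable fun n => a n * u ^ n) {u : ℝ} (hu : |u| < ρ) :
    seriesSum a u = a 0 + a 1 * u + a 2 * u ^ 2 + u ^ 3 * seriesSum (fun n => a (n + 3)) u := by
  have := (summable_of_abs_lt hρ h hu).sum_add_tsum_nat_add 3
  rw [seriesSum, ← this, seriesSum, ← tsum_mul_left]
  simp only [Finset.sum_range_succ, Finset.sum_range_zero]
  have e : ∀ n, a (n + 3) * u ^ (n + 3) = u ^ 3 * (a (n + 3) * u ^ n) := fun n => by ring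
  simp only [e]
  ring

end PowerSeries

/-! ### Calculus of second-order expansions at the origin -/

section Jets

theorem eventually_abs_lt {ρ : ℝ} (hρ : 0 < ρ) : ∀ᶠ u : ℝ in 𝓝 0, |u| < ρ := by
  filter_upwards [Metric.ball_mem_nhds (0 : ℝ) hρ] with u hu
  simpa using hu

/-- `F u = c₀ + c₁ u + c₂ u² + O(u³)` as `u → 0`. -/
def HasJet (F : ℝ → ℝ) (c₀ c₁ c₂ : ℝ) : Prop :=
  (fun u => F u - (c₀ + c₁ * u + c₂ * u ^ 2)) =O[𝓝 0] fun u => u ^ 3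

theorem isBigO_pow_mul {n : ℕ} {f : ℝ → ℝ} (hf : ContinuousAt f 0) :
    (fun u => u ^ n * f u) =O[𝓝 0] fun u : ℝ => u ^ n := by
  simpa using (isBigO_refl (fun u : ℝ => u ^ n) (𝓝 0)).mul (hf.tendsto.isBigO_one ℝ)

theorem isBigO_mul_of_tendsto {f g : ℝ → ℝ} {l : ℝ} (hg : g =O[𝓝 0] fun u : ℝ => u ^ 3)
    (hf : Tendsto f (𝓝 0) (𝓝 l)) : (fun u => f u * g u) =O[𝓝 0] fun u : ℝ => u ^ 3 := by
  simpa using (hf.isBigO_one ℝ).mul hg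

namespace HasJet

variable {F H : ℝ → ℝ} {c₀ c₁ c₂ d₀ d₁ d₂ : ℝ}

theorem poly_tendsto (c₀ c₁ c₂ : ℝ) :
    Tendsto (fun u : ℝ => c₀ + c₁ * u + c₂ * u ^ 2) (𝓝 0) (𝓝 c₀) := by
  have : ContinuousAt (fun u : ℝ => c₀ + c₁ * u + c₂ * u ^ 2) 0 := by fun_prop
  simpa [ContinuousAt] using this

theorem tendsto (h : HasJet F c₀ c₁ c₂) : Tendsto F (𝓝 0) (𝓝 c₀) := by
  have h3 : Tendsto (fun u : ℝ => u ^ 3) (𝓝 0) (𝓝 0) := by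
    have : ContinuousAt (fun u : ℝ => u ^ 3) 0 := by fun_prop
    simpa [ContinuousAt] using this
  simpa using (h.trans_tendsto h3).add (poly_tendsto c₀ c₁ c₂)

theorem congr' (h : HasJet F c₀ c₁ c₂) (e : H =ᶠ[𝓝 0] F) : HasJet H c₀ c₁ c₂ :=
  IsBigO.congr' h (e.mono fun u hu => by simp only [hu]) EventuallyEq.rfl

theorem of_eq (h : HasJet F c₀ c₁ c₂) (h₀ : c₀ = d₀) (h₁ : c₁ = d₁) (h₂ : c₂ = d₂) :
    HasJet F d₀ d₁ d₂ := by subst h₀ h₁ h₂; exact h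

theorem add (h : HasJet F c₀ c₁ c₂) (h' : HasJet H d₀ d₁ d₂) :
    HasJet (fun u => F u + H u) (c₀ + d₀) (c₁ + d₁) (c₂ + d₂) := by
  refine (IsBigO.add h h').congr_left fun u => ?_
  ring

theorem const_mul (h : HasJet F c₀ c₁ c₂) (k : ℝ) :
    HasJet (fun u => k * F u) (k * c₀) (k * c₁) (k * c₂) := by
  refine (IsBigO.const_mul_left h k).congr_left fun u => ?_
  ring

theorem const (k : ℝ) : HasJet (fun _ => k) k 0 0 := by
  simp only [HasJet]
  simpa using isBigO_zero (fun u : ℝ => u ^ 3) (𝓝 0)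

theorem id : HasJet (fun u => u) 0 1 0 := by
  simp only [HasJet]
  simpa using isBigO_zero (fun u : ℝ => u ^ 3) (𝓝 0)

theorem mul (h : HasJet F c₀ c₁ c₂) (h' : HasJet H d₀ d₁ d₂) :
    HasJet (fun u => F u * H u) (c₀ * d₀) (c₀ * d₁ + c₁ * d₀)
      (c₀ * d₂ + c₁ * d₁ + c₂ * d₀) := by
  have t1 := isBigO_mul_of_tendsto h h'.tendsto
  have t2 := isBigO_mul_of_tendsto h' (poly_tendsto c₀ c₁ c₂)
  have t3 : (fun u : ℝ => u ^ 3 * (c₁ * d₂ + c₂ * d₁ + c₂ * d₂ * u)) =O[𝓝 0] fun u : ℝ => u ^ 3 :=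
    isBigO_pow_mul (by fun_prop)
  refine ((t1.add t2).add t3).congr_left fun u => ?_
  ring

/-- If `p` is the candidate polynomial, then `F p - 1 = O(u³)`, and multiplying by the bounded
`-1/F` gives the error `1/F - p`. -/
theorem inv_of_one (h : HasJet F 1 c₁ c₂) : HasJet (fun u => (F u)⁻¹) 1 (-c₁) (c₁ ^ 2 - c₂) := by
  have hp : HasJet (fun u => 1 + -c₁ * u + (c₁ ^ 2 - c₂) * u ^ 2) 1 (-c₁) (c₁ ^ 2 - c₂) := by
    simp only [HasJet]
    simpa using isBigO_zero (fun u : ℝ => u ^ 3) (𝓝 0)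
  have hm := (h.mul hp).of_eq (d₀ := 1) (d₁ := 0) (d₂ := 0) (by ring) (by ring) (by ring)
  have hne : ∀ᶠ u in 𝓝 0, F u ≠ 0 := h.tendsto.eventually_ne one_ne_zero
  have := isBigO_mul_of_tendsto hm ((h.tendsto.inv₀ one_ne_zero).neg)
  refine this.congr' (hne.mono fun u hu => ?_) EventuallyEq.rfl
  field_simp
  ring

/-- If `p` is the candidate polynomial, then `F - p² = O(u³)`; dividing by `√F + p`, which tends to
`2`, gives `√F - p`. -/
theorem sqrt_of_one (h : HasJet F 1 c₁ c₂) :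
    HasJet (fun u => √(F u)) 1 (c₁ / 2) (c₂ / 2 - c₁ ^ 2 / 8) := by
  have hp : HasJet (fun u => 1 + c₁ / 2 * u + (c₂ / 2 - c₁ ^ 2 / 8) * u ^ 2) 1 (c₁ / 2)
      (c₂ / 2 - c₁ ^ 2 / 8) := by
    simp only [HasJet]
    simpa using isBigO_zero (fun u : ℝ => u ^ 3) (𝓝 0)
  have hs := (h.add ((hp.mul hp).const_mul (-1))).of_eq (d₀ := 0) (d₁ := 0) (d₂ := 0)
    (by ring) (by ring) (by ring)
  have ht : Tendsto (fun u => √(F u) + (1 + c₁ / 2 * u + (c₂ / 2 - c₁ ^ 2 / 8) * u ^ 2))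
      (𝓝 0) (𝓝 (1 + 1)) := by
    have := (Real.continuous_sqrt.tendsto 1).comp h.tendsto
    rw [Real.sqrt_one] at this
    exact this.add hp.tendsto
  have hpos : ∀ᶠ u in 𝓝 0, 0 < F u := h.tendsto.eventually_const_lt one_pos
  have hne := ht.eventually_ne (show (1 + 1 : ℝ) ≠ 0 by norm_num)
  have := isBigO_mul_of_tendsto hs (ht.inv₀ (show (1 + 1 : ℝ) ≠ 0 by norm_num))
  refine this.congr' ((hne.and hpos).mono fun u hu => ?_) EventuallyEq.rfl
  obtain ⟨hu, hu0⟩ := hu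
  have := Real.sq_sqrt hu0.le
  simp only
  rw [inv_mul_eq_iff_eq_mul₀ hu]
  linear_combination -this

theorem seriesSum {a : ℕ → ℝ} {ρ : ℝ} (hρ : 0 < ρ)
    (h : ∀ u : ℝ, 0 < u → u < ρ → Summable fun n => a n * u ^ n) :
    HasJet (seriesSum a) (a 0) (a 1) (a 2) := by
  have hc := (analyticAt_seriesSum hρ (summable_shift h 3) (u := 0) (by simpa)).continuousAt
  refine (isBigO_pow_mul (n := 3) hc).congr' ?_ EventuallyEq.rfl
  have : ∀ᶠ u : ℝ in 𝓝 0, |u| < ρ := eventually_abs_lt hρ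
  refine this.mono fun u hu => ?_
  simp only [seriesSum_eq_add_pow_mul hρ h hu]
  ring

/-- An `O(u³)` remainder cannot be differentiated, so the remainder is kept as `u³ T(u)` with `T`
analytic. The factor `u` restores the order lost by differentiation. -/
theorem mul_deriv_seriesSum {a : ℕ → ℝ} {ρ : ℝ} (hρ : 0 < ρ)
    (h : ∀ u : ℝ, 0 < u → u < ρ → Summable fun n => a n * u ^ n) :
    HasJet (fun u => u * deriv (PPM.seriesSum a) u) 0 (a 1) (2 * a 2) := by
  set T := PPM.seriesSum (fun n => a (n + 3)) with hT
  have hTan : ∀ u, |u| < ρ → AnalyticAt ℝ T u := fun u hu =>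
    analyticAt_seriesSum hρ (summable_shift h 3) hu
  have hev : ∀ᶠ u : ℝ in 𝓝 0, |u| < ρ := eventually_abs_lt hρ
  have h0 := hTan 0 (by simpa)
  have hc : ContinuousAt (fun u => 3 * T u + u * deriv T u) 0 := by
    have h1 := h0.continuousAt
    have h2 := h0.deriv.continuousAt
    fun_prop
  refine (isBigO_pow_mul (n := 3) hc).congr' ?_ EventuallyEq.rfl
  refine hev.eventually_nhds.mono fun u hu => ?_
  have e : PPM.seriesSum a =ᶠ[𝓝 u] fun u => a 0 + a 1 * u + a 2 * u ^ 2 + u ^ 3 * T u :=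
    hu.mono fun v hv => seriesSum_eq_add_pow_mul hρ h hv
  have hd := (hTan u hu.self_of_nhds).differentiableAt.hasDerivAt
  have hD := (((hasDerivAt_const u (a 0)).add ((hasDerivAt_id u).const_mul (a 1))).add
    ((hasDerivAt_pow 2 u).const_mul (a 2))).add ((hasDerivAt_pow 3 u).mul hd)
  have := (hD.congr_of_eventuallyEq (by simpa [Pi.add_def, Pi.mul_def] using e)).deriv
  simp only [this]
  push_cast
  ring

end HasJet

end Jets

/-! ### The refractive index and the bending function -/

namespace Potentials

variable {β γ ε : ℝ} (P : Potentials β γ ε)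

/-- The refractive index of the isotropic metric as a function of `u = m / r`. -/
def index (u : ℝ) : ℝ := √(seriesSum P.d u * (seriesSum P.a u)⁻¹)

/-- The logarithmic derivative `u (d/du) log n` of the refractive index. -/
def logSlope (u : ℝ) : ℝ :=
  1 / 2 * (u * deriv (seriesSum P.d) u * (seriesSum P.d u)⁻¹
    + -1 * (u * deriv (seriesSum P.a) u * (seriesSum P.a u)⁻¹))

theorem inv_h_pos : 0 < 1 / P.h := one_div_pos.2 P.h_pos

theorem analyticAt_a {u : ℝ} (hu : |u| < 1 / P.h) : AnalyticAt ℝ (seriesSum P.a) u :=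
  analyticAt_seriesSum P.inv_h_pos P.summable_a hu

theorem analyticAt_d {u : ℝ} (hu : |u| < 1 / P.h) : AnalyticAt ℝ (seriesSum P.d) u :=
  analyticAt_seriesSum P.inv_h_pos P.summable_d hu

theorem hasJet_a : HasJet (seriesSum P.a) 1 (-2) (2 * β) :=
  (HasJet.seriesSum P.inv_h_pos P.summable_a).of_eq P.a_zero P.a_one P.a_two

theorem hasJet_d : HasJet (seriesSum P.d) 1 (2 * γ) (3 / 2 * ε) :=
  (HasJet.seriesSum P.inv_h_pos P.summable_d).of_eq P.d_zero P.d_one P.d_two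

theorem hasJet_logSlope :
    HasJet P.logSlope 0 (1 + γ) (2 * kappa β γ ε - 2 * (1 + γ) ^ 2) := by
  have ha := HasJet.mul_deriv_seriesSum P.inv_h_pos P.summable_a
  have hd := HasJet.mul_deriv_seriesSum P.inv_h_pos P.summable_d
  rw [P.a_one, P.a_two] at ha
  rw [P.d_one, P.d_two] at hd
  have := ((hd.mul P.hasJet_d.inv_of_one).add
    ((ha.mul P.hasJet_a.inv_of_one).const_mul (-1))).const_mul (1 / 2)
  refine this.of_eq (by ring) (by ring) ?_
  rw [kappa]
  ring

theorem hasJet_index :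
    HasJet P.index 1 (1 + γ) (kappa β γ ε - (1 + γ) ^ 2 / 2) := by
  have := (P.hasJet_d.mul P.hasJet_a.inv_of_one).of_eq (d₀ := 1) (by ring) rfl rfl
  refine this.sqrt_of_one.of_eq rfl (by ring) ?_
  rw [kappa]
  ring

theorem hasJet_bending :
    HasJet (fun u => P.logSlope u * (1 + -1 * P.logSlope u)⁻¹) 0 (1 + γ)
      (2 * kappa β γ ε - (1 + γ) ^ 2) := by
  have h := P.hasJet_logSlope
  have h1 := ((HasJet.const 1).add (h.const_mul (-1))).of_eq (d₀ := 1) (by ring) rfl rfl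
  refine (h.mul h1.inv_of_one).of_eq (by ring) (by ring) (by ring)

/-- The quadratic coefficient becomes exactly `2κ` after the change of variable `v = u/n(u) = u - (1
+ γ) u² + O(u³)`, which absorbs the `-(1 + γ)²` of the expansion in `u`. -/
theorem isBigO_bending :
    (fun u => P.logSlope u * (1 + -1 * P.logSlope u)⁻¹
      - ((1 + γ) * (u * (P.index u)⁻¹) + 2 * kappa β γ ε * (u * (P.index u)⁻¹) ^ 2))
      =O[𝓝 0] fun u => u ^ 3 := by
  have hv := HasJet.id.mul P.hasJet_index.inv_of_one
  have := (P.hasJet_bending.add ((hv.const_mul (-(1 + γ))).add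
    ((hv.mul hv).const_mul (-(2 * kappa β γ ε))))).of_eq (d₀ := 0) (d₁ := 0) (d₂ := 0)
    (by ring) (by ring) (by ring)
  refine IsBigO.congr_left this fun u => ?_
  ring

theorem continuousAt_logSlope :
    ∀ᶠ u in 𝓝 0, ContinuousAt P.logSlope u := by
  have ha := P.hasJet_a.tendsto.eventually_ne one_ne_zero
  have hd := P.hasJet_d.tendsto.eventually_ne one_ne_zero
  filter_upwards [ha, hd, eventually_abs_lt P.inv_h_pos] with u h1 h2 h3
  have c1 := (P.analyticAt_a h3).continuousAt
  have c2 := (P.analyticAt_d h3).continuousAt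
  have c3 := (P.analyticAt_a h3).deriv.continuousAt
  have c4 := (P.analyticAt_d h3).deriv.continuousAt
  unfold logSlope
  fun_prop (disch := assumption)

/-- Nonzero strict derivative: the inverse function theorem then allows `v = u/n(u)` to replace `u`.
-/
theorem hasStrictDerivAt_div_index :
    HasStrictDerivAt (fun u => u * (P.index u)⁻¹) 1 0 := by
  have h0 : |(0 : ℝ)| < 1 / P.h := by simpa using P.h_pos
  have ha0 : seriesSum P.a 0 = 1 :=
    tendsto_nhds_unique (P.analyticAt_a h0).continuousAt P.hasJet_a.tendsto
  have hd0 : seriesSum P.d 0 = 1 :=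
    tendsto_nhds_unique (P.analyticAt_d h0).continuousAt P.hasJet_d.tendsto
  have ca : ContDiffAt ℝ 1 (seriesSum P.a) 0 := (P.analyticAt_a h0).contDiffAt
  have cd : ContDiffAt ℝ 1 (seriesSum P.d) 0 := (P.analyticAt_d h0).contDiffAt
  have hi : P.index 0 = 1 := by simp [index, ha0, hd0]
  have ci : ContDiffAt ℝ 1 P.index 0 :=
    (cd.mul (ca.inv (by rw [ha0]; exact one_ne_zero))).sqrt (by simp [ha0, hd0])
  have ck := ci.inv (by rw [hi]; exact one_ne_zero)
  have := (hasStrictDerivAt_id (0 : ℝ)).mul (ck.hasStrictDerivAt one_ne_zero)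
  simpa [hi, Pi.mul_def] using this

/-- The bending `d α / d ψ` of a light ray, as a function of `v = m / (r n)`. -/
theorem exists_bending : ∃ (u₀ v₀ C : ℝ) (Q : ℝ → ℝ), 0 < u₀ ∧ u₀ < 1 / P.h ∧ 0 < v₀ ∧ 0 < C ∧
    ContinuousOn Q (Metric.ball 0 v₀) ∧
    (∀ v, |v| < v₀ → |Q v| ≤ 1) ∧
    (∀ v, |v| < v₀ → |Q v - ((1 + γ) * v + 2 * kappa β γ ε * v ^ 2)| ≤ C * |v| ^ 3) ∧
    ∀ u, 0 < u → u ≤ u₀ → P.logSlope u < 1 ∧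
      Q (u * (P.index u)⁻¹) = P.logSlope u * (1 + -1 * P.logSlope u)⁻¹ := by
  have hg := P.hasStrictDerivAt_div_index
  set g : ℝ → ℝ := fun u => u * (P.index u)⁻¹ with hgdef
  set q : ℝ → ℝ := fun u => P.logSlope u * (1 + -1 * P.logSlope u)⁻¹ with hq
  have hE := hg.hasStrictFDerivAt_equiv one_ne_zero
  set e := hE.toOpenPartialHomeomorph g with he
  have heg : ∀ u, e u = g u := fun u => by rw [he, hE.toOpenPartialHomeomorph_coe]
  have h0s : (0 : ℝ) ∈ e.source := hE.mem_toOpenPartialHomeomorph_source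
  have he0 : e 0 = 0 := by simp [heg, hgdef]
  have h0t : (0 : ℝ) ∈ e.target := he0 ▸ e.map_source h0s
  have hes0 : e.symm 0 = 0 := by
    have := e.left_inv h0s
    rwa [he0] at this
  have hU : Tendsto e.symm (𝓝 0) (𝓝 0) := by
    have := (e.continuousOn_symm.continuousAt (e.open_target.mem_nhds h0t)).tendsto
    rwa [hes0] at this
  have hslope : ∀ᶠ u in 𝓝 0, P.logSlope u < 1 :=
    P.hasJet_logSlope.tendsto.eventually_lt_const one_pos
  obtain ⟨C, hC0, hC⟩ := P.isBigO_bending.exists_pos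
  have hCb := hC.bound
  have hidx : ∀ᶠ u in 𝓝 0, P.index u ∈ Ioo 0 2 :=
    P.hasJet_index.tendsto.eventually (Ioo_mem_nhds (by norm_num) (by norm_num))
  have hone : ∀ᶠ u in 𝓝 0, |q u| < 1 := by
    have := P.hasJet_bending.tendsto.abs
    rw [abs_zero] at this
    exact this.eventually_lt_const one_pos
  have hu : ∀ᶠ u in 𝓝 0, P.logSlope u < 1 ∧ u ∈ e.source :=
    hslope.and (e.open_source.mem_nhds h0s)
  have hv := (e.open_target.eventually_mem h0t).and
    (hU.eventually ((P.continuousAt_logSlope.and hslope).and ((hCb.and hidx).and hone)))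
  obtain ⟨u₁, hu₁, hu₁'⟩ := Metric.eventually_nhds_iff.1 hu
  obtain ⟨v₀, hv₀, hv₀'⟩ := Metric.eventually_nhds_iff.1 hv
  simp only [dist_zero_right, Real.norm_eq_abs] at hu₁' hv₀'
  have hh := P.inv_h_pos
  -- `Q` is `q` composed with the local inverse of `u ↦ u/n(u)`. The factor `8` comes from `n < 2`:
  -- then `|u| ≤ 2|v|`, so `|u|³ ≤ 8|v|³`.
  refine ⟨min (u₁ / 2) (1 / P.h / 2), v₀, C * 8, fun v => q (e.symm v), by positivity,
    (min_le_right _ _).trans_lt (by linarith), hv₀, by positivity, ?_, ?_, ?_, ?_⟩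
  · intro v hv
    have hv : |v| < v₀ := by simpa using hv
    obtain ⟨ht, ⟨hc, hl⟩, -⟩ := hv₀' hv
    have hs := e.continuousOn_symm.continuousAt (e.open_target.mem_nhds ht)
    have hcq : ContinuousAt q (e.symm v) := by
      have : 1 + -1 * P.logSlope (e.symm v) ≠ 0 := by linarith
      simp only [hq]
      fun_prop (disch := assumption)
    exact (ContinuousAt.comp (f := e.symm) (g := q) hcq hs).continuousWithinAt
  · intro v hv
    exact (hv₀' hv).2.2.2.le
  · intro v hv
    obtain ⟨ht, -, ⟨hb, hi⟩, -⟩ := hv₀' hv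
    have hr : g (e.symm v) = v := by rw [← heg]; exact e.right_inv ht
    have hr' : e.symm v * (P.index (e.symm v))⁻¹ = v := hr
    rw [hr'] at hb
    refine hb.trans ?_
    have hle : |e.symm v| ≤ 2 * |v| := by
      have : e.symm v = v * P.index (e.symm v) := by
        rw [← hr', mul_assoc, hr', inv_mul_cancel₀ hi.1.ne', mul_one]
      rw [this, abs_mul, abs_of_pos hi.1, mul_comm]
      exact mul_le_mul_of_nonneg_right hi.2.le (abs_nonneg _)
    rw [abs_pow, mul_assoc]
    refine mul_le_mul_of_nonneg_left ?_ hC0.le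
    calc |e.symm v| ^ 3 ≤ (2 * |v|) ^ 3 := by gcongr
      _ = 8 * |v| ^ 3 := by ring
  · intro u hu hu'
    have : |u| < u₁ := by
      rw [abs_of_pos hu]
      linarith [min_le_left (u₁ / 2) (1 / P.h / 2)]
    obtain ⟨h1, h2⟩ := hu₁' this
    refine ⟨h1, ?_⟩
    have := e.left_inv h2
    rw [heg] at this
    change q (e.symm (g u)) = _
    rw [this]

end Potentials

/-! ### Null geodesics as rays of geometrical optics -/

open scoped RealInnerProductSpace

theorem hasDerivAt_triple {f : ℝ → Triple} {f' : Triple} {t : ℝ}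
    (h : ∀ i, HasDerivAt (fun s => f s i) (f' i) t) : HasDerivAt f f' t := by
  have := (PiLp.hasFDerivAt_toLp (𝕜 := ℝ) 2 (fun i => f t i)).comp_hasDerivAt t
    (hasDerivAt_pi.2 h)
  exact this

theorem hasFDerivAt_norm_snd {y : Spacetime} (hy : y.2 ≠ 0) :
    HasFDerivAt (fun z : Spacetime => ‖z.2‖)
      (‖y.2‖⁻¹ • (innerSL ℝ y.2).comp (ContinuousLinearMap.snd ℝ ℝ Triple)) y := by
  have h := ((hasFDerivAt_snd (𝕜 := ℝ) (p := y)).norm_sq).sqrt (by simpa using hy)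
  have e : (fun z : Spacetime => √(‖z.2‖ ^ 2)) = fun z => ‖z.2‖ := by
    funext z
    exact Real.sqrt_sq (norm_nonneg _)
  rw [e] at h
  refine h.congr_fderiv ?_
  ext w
  · simp
  · simp [Real.sqrt_sq (norm_nonneg _)]
    ring

namespace Potentials

variable {β γ ε : ℝ} (P : Potentials β γ ε)

theorem metric_apply (m : ℝ) (y v w : Spacetime) :
    P.metric m y v w = seriesSum P.a (m / ‖y.2‖) * (v.1 * w.1)
      - seriesSum P.d (m / ‖y.2‖) * ⟪v.2, w.2⟫ := by
  simp [metric, isotropicMetric, potA, potB, seriesSum]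

theorem fderiv_metric {m : ℝ} {y : Spacetime} (hy : y.2 ≠ 0) (hm : |m / ‖y.2‖| < 1 / P.h)
    (v w : Spacetime) :
    fderiv ℝ (fun z => P.metric m z v v) y w =
      -(m / ‖y.2‖ ^ 3) * (deriv (seriesSum P.a) (m / ‖y.2‖) * v.1 ^ 2
        - deriv (seriesSum P.d) (m / ‖y.2‖) * ‖v.2‖ ^ 2) * ⟪y.2, w.2⟫ := by
  have hr : ‖y.2‖ ≠ 0 := norm_ne_zero_iff.2 hy
  have hu : HasDerivAt (fun r : ℝ => m / r) (-(m / ‖y.2‖ ^ 2)) ‖y.2‖ := by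
    refine ((hasDerivAt_inv hr).const_mul m).congr_deriv ?_
    field_simp
  have ha := (P.analyticAt_a hm).differentiableAt.hasDerivAt.comp _ hu
  have hd := (P.analyticAt_d hm).differentiableAt.hasDerivAt.comp _ hu
  have h := ((ha.mul_const (v.1 * v.1)).sub (hd.mul_const ⟪v.2, v.2⟫)).comp_hasFDerivAt y
    (hasFDerivAt_norm_snd hy)
  have e : (fun z => P.metric m z v v) = (fun r =>
      (seriesSum P.a ∘ fun r => m / r) r * (v.1 * v.1)
        - (seriesSum P.d ∘ fun r => m / r) r * ⟪v.2, v.2⟫) ∘ fun z : Spacetime => ‖z.2‖ := by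
    funext z
    simp [metric_apply]
  rw [e]
  erw [h.fderiv]
  simp only [smul_apply, ContinuousLinearMap.comp_apply,
    ContinuousLinearMap.coe_snd', innerSL_apply_apply, smul_eq_mul, real_inner_self_eq_norm_sq]
  field_simp
  ring

/-- Along a light ray, with `p = -(l_i / l_0)` and `σ` the affine parameter, the ray equations of
geometrical optics hold in the medium of the given refractive index. -/
theorem exists_optical {m : ℝ} (hm : 0 < m) {x : ℝ → Spacetime}
    (hx : IsLightRayOn (P.metric m) x univ) (hr : ∀ σ, P.rh m < ‖(x σ).2‖) :
    ∃ lam : ℝ → ℝ, ∀ σ, 0 < lam σ ∧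
      (deriv x σ).2 = lam σ • -directionTriple (P.metric m) (x σ) (deriv x σ) ∧
      HasDerivAt (fun τ => (x τ).2)
        (lam σ • -directionTriple (P.metric m) (x σ) (deriv x σ)) σ ∧
      HasDerivAt (fun τ => -directionTriple (P.metric m) (x τ) (deriv x τ))
        (-(lam σ * (‖-directionTriple (P.metric m) (x σ) (deriv x σ)‖ ^ 2 / ‖(x σ).2‖ ^ 2)
          * P.logSlope (m / ‖(x σ).2‖)) • (x σ).2) σ ∧
      ‖-directionTriple (P.metric m) (x σ) (deriv x σ)‖ = P.index (m / ‖(x σ).2‖) := by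
  have hrh : 0 < P.rh m := mul_pos P.h_pos hm
  have hpos : ∀ σ, 0 < ‖(x σ).2‖ := fun σ => hrh.trans (hr σ)
  have hne : ∀ σ, (x σ).2 ≠ 0 := fun σ => norm_pos_iff.1 (hpos σ)
  have hu0 : ∀ σ, 0 < m / ‖(x σ).2‖ := fun σ => div_pos hm (hpos σ)
  have hu1 : ∀ σ, m / ‖(x σ).2‖ < 1 / P.h := fun σ => by
    rw [div_lt_div_iff₀ (hpos σ) P.h_pos, one_mul, mul_comm]
    exact hr σ
  have hu : ∀ σ, |m / ‖(x σ).2‖| < 1 / P.h := fun σ => by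
    rw [abs_of_pos (hu0 σ)]
    exact hu1 σ
  have hA : ∀ σ, 0 < seriesSum P.a (m / ‖(x σ).2‖) := fun σ => P.a_pos _ (hu0 σ) (hu1 σ)
  have hD : ∀ σ, 0 < seriesSum P.d (m / ‖(x σ).2‖) := fun σ => P.d_pos _ (hu0 σ) (hu1 σ)
  obtain ⟨hdiff, hgeo, hnull, hfut⟩ := hx
  simp only [derivWithin_univ, mem_univ, forall_true_left, hasDerivWithinAt_univ] at hgeo hnull hfut
  have hxd : ∀ σ, HasDerivAt x (deriv x σ) σ := fun σ =>
    ((hdiff σ (mem_univ σ)).differentiableAt univ_mem).hasDerivAt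
  -- The metric is static, so `l_0` is conserved.
  obtain ⟨E, hE⟩ : ∃ E, ∀ σ, P.metric m (x σ) (deriv x σ) (1, 0) = E := by
    refine ⟨_, fun σ => is_const_of_deriv_eq_zero (𝕜 := ℝ)
      (fun τ => (hgeo τ (1, 0)).differentiableAt) (fun τ => ?_) σ 0⟩
    rw [(hgeo τ (1, 0)).deriv, P.fderiv_metric (hne τ) (hu τ)]
    simp
  have hE' : ∀ σ, seriesSum P.a (m / ‖(x σ).2‖) * (deriv x σ).1 = E := fun σ => by
    rw [← hE σ, metric_apply]
    simp
  have hEpos : 0 < E := by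
    rw [← hE' 0]
    exact mul_pos (hA 0) (hfut 0)
  have hp : ∀ σ, -directionTriple (P.metric m) (x σ) (deriv x σ)
      = (seriesSum P.d (m / ‖(x σ).2‖) / E) • (deriv x σ).2 := fun σ => by
    ext i
    simp only [directionTriple, hE, metric_apply, PiLp.neg_apply, PiLp.smul_apply, smul_eq_mul,
      EuclideanSpace.inner_single_right]
    simp
    ring
  have hn : ∀ σ, seriesSum P.a (m / ‖(x σ).2‖) * (deriv x σ).1 ^ 2
      = seriesSum P.d (m / ‖(x σ).2‖) * ‖(deriv x σ).2‖ ^ 2 := fun σ => by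
    have := hnull σ
    rw [metric_apply, real_inner_self_eq_norm_sq] at this
    linear_combination this
  -- Only `x` and the covector `l` are known to be differentiable; the ray equations in `(X, p)`
  -- never differentiate this factor.
  refine ⟨fun σ => E / seriesSum P.d (m / ‖(x σ).2‖), fun σ => ?_⟩
  have hdσ := (hD σ).ne'
  have haσ := (hA σ).ne'
  have hrσ := (hpos σ).ne'
  have hV : (deriv x σ).2 = (E / seriesSum P.d (m / ‖(x σ).2‖)) •
      -directionTriple (P.metric m) (x σ) (deriv x σ) := by
    rw [hp, smul_smul]
    field_simp
    simp
  refine ⟨div_pos hEpos (hD σ), hV, ?_, ?_, ?_⟩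
  · rw [← hV]
    exact (hasFDerivAt_snd (𝕜 := ℝ) (p := x σ)).comp_hasDerivAt σ (hxd σ)
  · refine hasDerivAt_triple fun i => ?_
    have h := ((hgeo σ (0, EuclideanSpace.single i 1)).div_const E).neg
    have e : (fun τ => (-directionTriple (P.metric m) (x τ) (deriv x τ)) i) =
        -fun τ => P.metric m (x τ) (deriv x τ) (0, EuclideanSpace.single i 1) / E := by
      funext τ
      simp [directionTriple, hE]
    rw [e]
    refine h.congr_deriv ?_
    rw [P.fderiv_metric (hne σ) (hu σ), hp, norm_smul, Real.norm_eq_abs,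
      abs_of_pos (div_pos (hD σ) hEpos), logSlope]
    simp only [EuclideanSpace.inner_single_right, PiLp.smul_apply, smul_eq_mul]
    simp only [conj_trivial, one_mul]
    have h1 := hn σ
    have hEne := hEpos.ne'
    generalize (deriv x σ).1 = V at *
    generalize ‖(deriv x σ).2‖ = W at *
    generalize deriv (seriesSum P.a) (m / ‖(x σ).2‖) = a' at *
    generalize deriv (seriesSum P.d) (m / ‖(x σ).2‖) = d' at *
    generalize seriesSum P.a (m / ‖(x σ).2‖) = a at *
    generalize seriesSum P.d (m / ‖(x σ).2‖) = d at *
    field_simp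
    -- The null condition trades the `(dx⁰/dσ)²` term in the force for the spatial speed, so that
    -- the derivatives of both potentials combine into `logSlope`.
    linear_combination ((x σ).2 i * a') * h1
  · rw [hp, norm_smul, Real.norm_eq_abs, abs_of_pos (div_pos (hD σ) hEpos), index, eq_comm,
      Real.sqrt_eq_iff_eq_sq (by have := hA σ; have := hD σ; positivity)
        (by have := hD σ; positivity)]
    have h1 := hn σ
    rw [← hE' σ]
    have := (hfut σ).ne'
    field_simp
    linear_combination h1

end Potentials

/-! ### Rays in a spherically symmetric medium -/

section Optics

variable {V : Type*} [NormedAddCommGroup V] [InnerProductSpace ℝ V]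

/-- A solution of the ray equations of a spherically symmetric medium: `q` is the logarithmic
derivative of the refractive index `‖p‖` with respect to `1 / ‖X‖`. -/
structure IsOpticalRay (X p : ℝ → V) (lam q : ℝ → ℝ) : Prop where
  lam_pos : ∀ σ, 0 < lam σ
  ne_zero : ∀ σ, X σ ≠ 0
  hasDerivAt_position : ∀ σ, HasDerivAt X (lam σ • p σ) σ
  hasDerivAt_momentum : ∀ σ,
    HasDerivAt p (-(lam σ * (‖p σ‖ ^ 2 / ‖X σ‖ ^ 2) * q σ) • X σ) σ

/-- The unit radial vector. -/
def radialUnit (X : ℝ → V) (σ : ℝ) : V := ‖X σ‖⁻¹ • X σ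

/-- The unit vector orthogonal to the position, in the plane of the position and the momentum. -/
def transverseUnit (X p : ℝ → V) (b : ℝ) (σ : ℝ) : V :=
  b⁻¹ • (‖X σ‖ • p σ - ⟪X σ, p σ⟫ • radialUnit X σ)

namespace IsOpticalRay

variable {X p : ℝ → V} {lam q : ℝ → ℝ}

theorem norm_pos (h : IsOpticalRay X p lam q) (σ : ℝ) : 0 < ‖X σ‖ := norm_pos_iff.2 (h.ne_zero σ)

theorem hasDerivAt_inner (h : IsOpticalRay X p lam q) (σ : ℝ) :
    HasDerivAt (fun τ => ⟪X τ, p τ⟫) (lam σ * ‖p σ‖ ^ 2 * (1 - q σ)) σ := by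
  refine ((h.hasDerivAt_position σ).inner ℝ (h.hasDerivAt_momentum σ)).congr_deriv ?_
  have := (h.norm_pos σ).ne'
  rw [inner_smul_right, inner_smul_left, real_inner_self_eq_norm_sq, real_inner_self_eq_norm_sq]
  simp only [conj_trivial]
  field_simp
  ring

theorem hasDerivAt_norm (h : IsOpticalRay X p lam q) (σ : ℝ) :
    HasDerivAt (fun τ => ‖X τ‖) (lam σ * ⟪X σ, p σ⟫ / ‖X σ‖) σ := by
  have h1 := (h.hasDerivAt_position σ).norm_sq.sqrt (by simpa using h.ne_zero σ)
  have e : (fun τ => √(‖X τ‖ ^ 2)) = fun τ => ‖X τ‖ := by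
    funext τ
    exact Real.sqrt_sq (norm_nonneg _)
  rw [e] at h1
  refine h1.congr_deriv ?_
  have := (h.norm_pos σ).ne'
  rw [Real.sqrt_sq (norm_nonneg _), inner_smul_right]
  field_simp

/-- Bouguer's invariant. -/
theorem invariant (h : IsOpticalRay X p lam q) (σ τ : ℝ) :
    ‖X σ‖ ^ 2 * ‖p σ‖ ^ 2 - ⟪X σ, p σ⟫ ^ 2 = ‖X τ‖ ^ 2 * ‖p τ‖ ^ 2 - ⟪X τ, p τ⟫ ^ 2 := by
  have hd : ∀ σ, HasDerivAt (fun σ => ‖X σ‖ ^ 2 * ‖p σ‖ ^ 2 - ⟪X σ, p σ⟫ ^ 2) 0 σ := fun σ => by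
    refine (((h.hasDerivAt_position σ).norm_sq.mul (h.hasDerivAt_momentum σ).norm_sq).sub
      ((h.hasDerivAt_inner σ).pow 2)).congr_deriv ?_
    have := (h.norm_pos σ).ne'
    rw [inner_smul_right, inner_smul_right, real_inner_comm (X σ) (p σ)]
    push_cast
    field_simp
    ring
  exact is_const_of_deriv_eq_zero (𝕜 := ℝ) (fun σ => (hd σ).differentiableAt)
    (fun σ => (hd σ).deriv) σ τ

variable {b : ℝ} {J : ℝ → ℝ}

theorem hasDerivAt_radialUnit (h : IsOpticalRay X p lam q) (hb : 0 < b) (σ : ℝ) :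
    HasDerivAt (radialUnit X) ((lam σ * b / ‖X σ‖ ^ 2) • transverseUnit X p b σ) σ := by
  have hr := (h.norm_pos σ).ne'
  refine (((h.hasDerivAt_norm σ).inv hr).smul (h.hasDerivAt_position σ)).congr_deriv ?_
  rw [transverseUnit, radialUnit, Pi.inv_apply]
  match_scalars
  · field_simp
  · field_simp

theorem hasDerivAt_transverseUnit (h : IsOpticalRay X p lam q) (hb : 0 < b)
    (hinv : ∀ σ, ‖X σ‖ ^ 2 * ‖p σ‖ ^ 2 - ⟪X σ, p σ⟫ ^ 2 = b ^ 2) (σ : ℝ) :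
    HasDerivAt (transverseUnit X p b) (-(lam σ * b / ‖X σ‖ ^ 2) • radialUnit X σ) σ := by
  have hr := (h.norm_pos σ).ne'
  refine ((((h.hasDerivAt_norm σ).smul (h.hasDerivAt_momentum σ)).sub
    ((h.hasDerivAt_inner σ).smul (h.hasDerivAt_radialUnit hb σ))).const_smul b⁻¹).congr_deriv ?_
  rw [transverseUnit, radialUnit]
  have hi := hinv σ
  match_scalars
  · field_simp
    ring_nf
    linear_combination (-lam σ) * hi
  · field_simp
    ring

/-- The factor `1 - q` in the derivative of `⟪X, p⟫` cancels against `J' = 1/(1 - q)`, and the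
invariant turns the denominator `b² + ⟪X, p⟫²` of the arctangent into `‖X‖²‖p‖²`. What remains is
the rotation rate of the radial unit vector. -/
theorem hasDerivAt_polarAngle (h : IsOpticalRay X p lam q) (hb : 0 < b)
    (hinv : ∀ σ, ‖X σ‖ ^ 2 * ‖p σ‖ ^ 2 - ⟪X σ, p σ⟫ ^ 2 = b ^ 2) (hq : ∀ σ, q σ < 1)
    (hJ : ∀ σ, HasDerivAt J (1 - q σ)⁻¹ (Real.arctan (⟪X σ, p σ⟫ / b))) (σ : ℝ) :
    HasDerivAt (fun τ => J (Real.arctan (⟪X τ, p τ⟫ / b))) (lam σ * b / ‖X σ‖ ^ 2) σ := by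
  have hr := (h.norm_pos σ).ne'
  refine ((hJ σ).comp σ ((h.hasDerivAt_inner σ).div_const b).arctan).congr_deriv ?_
  have hq' : 1 - q σ ≠ 0 := (sub_pos.2 (hq σ)).ne'
  have hs : b ^ 2 + ⟪X σ, p σ⟫ ^ 2 ≠ 0 := by positivity
  have hi := hinv σ
  rw [div_pow]
  field_simp
  linear_combination lam σ * hi

/-- The position in polar coordinates, the angle being counted from the point `σP`. -/
theorem radialUnit_eq (h : IsOpticalRay X p lam q) (hb : 0 < b)
    (hinv : ∀ σ, ‖X σ‖ ^ 2 * ‖p σ‖ ^ 2 - ⟪X σ, p σ⟫ ^ 2 = b ^ 2) (hq : ∀ σ, q σ < 1)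
    (hJ : ∀ σ, HasDerivAt J (1 - q σ)⁻¹ (Real.arctan (⟪X σ, p σ⟫ / b))) (hJ0 : J 0 = 0) {σP : ℝ}
    (hP : ⟪X σP, p σP⟫ = 0) (σ : ℝ) :
    radialUnit X σ = Real.cos (J (Real.arctan (⟪X σ, p σ⟫ / b))) • radialUnit X σP
      + Real.sin (J (Real.arctan (⟪X σ, p σ⟫ / b))) • transverseUnit X p b σP := by
  set θ : ℝ → ℝ := fun τ => J (Real.arctan (⟪X τ, p τ⟫ / b)) with hθ
  have dθ := h.hasDerivAt_polarAngle hb hinv hq hJ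
  have dx := h.hasDerivAt_radialUnit hb
  have dt := h.hasDerivAt_transverseUnit hb hinv
  have hP0 : θ σP = 0 := by simp [hθ, hP, hJ0]
  -- The moving frame rotates at the rate `θ'`, so turning it back by `θ` gives two constant
  -- vectors.
  have d1 : ∀ σ, HasDerivAt (fun τ => Real.cos (θ τ) • radialUnit X τ
      - Real.sin (θ τ) • transverseUnit X p b τ) 0 σ := fun σ => by
    refine (((dθ σ).cos.smul (dx σ)).sub ((dθ σ).sin.smul (dt σ))).congr_deriv ?_
    module
  have d2 : ∀ σ, HasDerivAt (fun τ => Real.sin (θ τ) • radialUnit X τ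
      + Real.cos (θ τ) • transverseUnit X p b τ) 0 σ := fun σ => by
    refine (((dθ σ).sin.smul (dx σ)).add ((dθ σ).cos.smul (dt σ))).congr_deriv ?_
    module
  have c1 := is_const_of_deriv_eq_zero (𝕜 := ℝ) (fun σ => (d1 σ).differentiableAt)
    (fun σ => (d1 σ).deriv) σ σP
  have c2 := is_const_of_deriv_eq_zero (𝕜 := ℝ) (fun σ => (d2 σ).differentiableAt)
    (fun σ => (d2 σ).deriv) σ σP
  simp only [hP0, Real.cos_zero, Real.sin_zero, one_smul, zero_smul, sub_zero, zero_add] at c1 c2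
  rw [← c1, ← c2]
  have := Real.sin_sq_add_cos_sq (θ σ)
  change _ = Real.cos (θ σ) • _ + Real.sin (θ σ) • _
  match_scalars
  · linear_combination -this
  · ring

theorem norm_radialUnit (h : IsOpticalRay X p lam q) (σ : ℝ) : ‖radialUnit X σ‖ = 1 := by
  rw [radialUnit, norm_smul, norm_inv, norm_norm, inv_mul_cancel₀ (h.norm_pos σ).ne']

theorem inner_radialUnit_transverseUnit (h : IsOpticalRay X p lam q) (σ : ℝ) :
    ⟪radialUnit X σ, transverseUnit X p b σ⟫ = 0 := by
  have hr := (h.norm_pos σ).ne'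
  rw [transverseUnit, inner_smul_right, inner_sub_right, inner_smul_right, inner_smul_right,
    real_inner_self_eq_norm_sq, h.norm_radialUnit, radialUnit, inner_smul_left, conj_trivial]
  field_simp
  simp

theorem norm_transverseUnit (h : IsOpticalRay X p lam q) (hb : 0 < b)
    (hinv : ∀ σ, ‖X σ‖ ^ 2 * ‖p σ‖ ^ 2 - ⟪X σ, p σ⟫ ^ 2 = b ^ 2) (σ : ℝ) :
    ‖transverseUnit X p b σ‖ = 1 := by
  have hr := (h.norm_pos σ).ne'
  have h2 : ‖transverseUnit X p b σ‖ ^ 2 = 1 := by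
    rw [transverseUnit, norm_smul, mul_pow, norm_sub_sq_real, norm_smul, norm_smul,
      inner_smul_left, inner_smul_right, h.norm_radialUnit, radialUnit, inner_smul_right,
      real_inner_comm (X σ) (p σ)]
    simp only [conj_trivial, Real.norm_eq_abs, mul_one, sq_abs, mul_pow, norm_inv,
      inv_pow]
    field_simp
    linear_combination hinv σ
  nlinarith [norm_nonneg (transverseUnit X p b σ)]

theorem momentum_eq (h : IsOpticalRay X p lam q) (hb : 0 < b) (σ : ℝ) :
    p σ = (b * ‖X σ‖⁻¹) • transverseUnit X p b σ + (⟪X σ, p σ⟫ * ‖X σ‖⁻¹) • radialUnit X σ := by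
  have hr := (h.norm_pos σ).ne'
  rw [transverseUnit]
  match_scalars
  · field_simp
  · field_simp
    ring

theorem monotone_inner (h : IsOpticalRay X p lam q) (hq : ∀ σ, q σ < 1) :
    Monotone fun σ => ⟪X σ, p σ⟫ := by
  refine monotone_of_deriv_nonneg (fun σ => (h.hasDerivAt_inner σ).differentiableAt) fun σ => ?_
  rw [(h.hasDerivAt_inner σ).deriv]
  have := h.lam_pos σ
  have := sub_pos.2 (hq σ)
  positivity

/-- Bouguer's invariant divided by `‖X‖²`: the square of the quantity is `‖p‖² - b²/‖X‖²`. -/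
theorem tendsto_abs_inner_div (h : IsOpticalRay X p lam q)
    (hinv : ∀ σ, ‖X σ‖ ^ 2 * ‖p σ‖ ^ 2 - ⟪X σ, p σ⟫ ^ 2 = b ^ 2) {l : Filter ℝ}
    (hX : Tendsto (fun σ => ‖X σ‖) l atTop) (hp : Tendsto (fun σ => ‖p σ‖) l (𝓝 1)) :
    Tendsto (fun σ => |⟪X σ, p σ⟫| * ‖X σ‖⁻¹) l (𝓝 1) := by
  have h1 : Tendsto (fun σ => √(‖p σ‖ ^ 2 - b ^ 2 * (‖X σ‖⁻¹) ^ 2)) l (𝓝 (√(1 ^ 2 - b ^ 2 * 0 ^ 2))) :=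
    ((hp.pow 2).sub (((tendsto_inv_atTop_zero.comp hX).pow 2).const_mul _)).sqrt
  simp only [one_pow, ne_eq, OfNat.ofNat_ne_zero, not_false_eq_true, zero_pow, mul_zero, sub_zero,
    Real.sqrt_one] at h1
  refine h1.congr fun σ => ?_
  have hr := (h.norm_pos σ).ne'
  rw [Real.sqrt_eq_iff_eq_sq _ (by positivity)]
  · rw [mul_pow, sq_abs, ← hinv σ]
    field_simp
    ring
  · rw [← hinv σ]
    have : ‖p σ‖ ^ 2 - (‖X σ‖ ^ 2 * ‖p σ‖ ^ 2 - ⟪X σ, p σ⟫ ^ 2) * ‖X σ‖⁻¹ ^ 2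
        = (⟪X σ, p σ⟫ * ‖X σ‖⁻¹) ^ 2 := by
      field_simp
      ring
    rw [this]
    positivity

/-- The asymptotic directions of a ray with periapsis `σP`. -/
theorem exists_asymptotes (h : IsOpticalRay X p lam q) (hb : 0 < b)
    (hinv : ∀ σ, ‖X σ‖ ^ 2 * ‖p σ‖ ^ 2 - ⟪X σ, p σ⟫ ^ 2 = b ^ 2) (hq : ∀ σ, q σ < 1)
    (hJ : ∀ σ, HasDerivAt J (1 - q σ)⁻¹ (Real.arctan (⟪X σ, p σ⟫ / b))) (hJ0 : J 0 = 0)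
    (hJodd : ∀ t, J (-t) = -J t) (hJc : Continuous J) {σP : ℝ} (hP : ⟪X σP, p σP⟫ = 0)
    (hXt : Tendsto (fun σ => ‖X σ‖) atTop atTop) (hXb : Tendsto (fun σ => ‖X σ‖) atBot atTop)
    (hpt : Tendsto (fun σ => ‖p σ‖) atTop (𝓝 1)) (hpb : Tendsto (fun σ => ‖p σ‖) atBot (𝓝 1)) :
    ∃ e : V, ‖e‖ = 1 ∧ ⟪radialUnit X σP, e⟫ = 0 ∧
      Tendsto (radialUnit X) atBot (𝓝 (Real.cos (J (Real.pi / 2)) • radialUnit X σP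
        - Real.sin (J (Real.pi / 2)) • e)) ∧
      Tendsto p atTop (𝓝 (Real.cos (J (Real.pi / 2)) • radialUnit X σP
        + Real.sin (J (Real.pi / 2)) • e)) := by
  have hmono := h.monotone_inner hq
  have ht := h.tendsto_abs_inner_div hinv hXt hpt
  have hbt := h.tendsto_abs_inner_div hinv hXb hpb
  have hpos : ∀ᶠ σ in atTop, 0 ≤ ⟪X σ, p σ⟫ := by
    filter_upwards [eventually_ge_atTop σP] with σ hσ
    exact hP ▸ hmono hσ
  have hneg : ∀ᶠ σ in atBot, ⟪X σ, p σ⟫ ≤ 0 := by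
    filter_upwards [eventually_le_atBot σP] with σ hσ
    exact hP ▸ hmono hσ
  have ht' : Tendsto (fun σ => ⟪X σ, p σ⟫ * ‖X σ‖⁻¹) atTop (𝓝 1) :=
    ht.congr' (hpos.mono fun σ hσ => by simp only [abs_of_nonneg hσ])
  have hbt' : Tendsto (fun σ => ⟪X σ, p σ⟫ * ‖X σ‖⁻¹) atBot (𝓝 (-1)) :=
    hbt.neg.congr' (hneg.mono fun σ hσ => by simp only [abs_of_nonpos hσ]; ring)
  have hst : Tendsto (fun σ => ⟪X σ, p σ⟫ / b) atTop atTop := by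
    refine ((ht'.pos_mul_atTop one_pos hXt).atTop_div_const hb).congr fun σ => ?_
    rw [inv_mul_cancel_right₀ (h.norm_pos σ).ne']
  have hsb : Tendsto (fun σ => ⟪X σ, p σ⟫ / b) atBot atBot := by
    refine ((hbt'.neg_mul_atTop (by norm_num) hXb).atBot_div_const hb).congr fun σ => ?_
    rw [inv_mul_cancel_right₀ (h.norm_pos σ).ne']
  have hθt : Tendsto (fun σ => J (Real.arctan (⟪X σ, p σ⟫ / b))) atTop (𝓝 (J (Real.pi / 2))) :=
    (hJc.tendsto _).comp ((Real.tendsto_arctan_atTop.mono_right nhdsWithin_le_nhds).comp hst)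
  have hθb : Tendsto (fun σ => J (Real.arctan (⟪X σ, p σ⟫ / b))) atBot (𝓝 (-J (Real.pi / 2))) := by
    rw [← hJodd]
    exact (hJc.tendsto _).comp ((Real.tendsto_arctan_atBot.mono_right nhdsWithin_le_nhds).comp hsb)
  have hx := h.radialUnit_eq hb hinv hq hJ hJ0 hP
  refine ⟨transverseUnit X p b σP, h.norm_transverseUnit hb hinv σP,
    h.inner_radialUnit_transverseUnit σP, ?_, ?_⟩
  · have := (((Real.continuous_cos.tendsto _).comp hθb).smul_const (radialUnit X σP)).add
      (((Real.continuous_sin.tendsto _).comp hθb).smul_const (transverseUnit X p b σP))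
    rw [Real.cos_neg, Real.sin_neg, neg_smul, ← sub_eq_add_neg] at this
    exact this.congr fun σ => (hx σ).symm
  · have h1 := (((Real.continuous_cos.tendsto _).comp hθt).smul_const (radialUnit X σP)).add
      (((Real.continuous_sin.tendsto _).comp hθt).smul_const (transverseUnit X p b σP))
    have h2 : Tendsto (radialUnit X) atTop (𝓝 (Real.cos (J (Real.pi / 2)) • radialUnit X σP
        + Real.sin (J (Real.pi / 2)) • transverseUnit X p b σP)) :=
      h1.congr fun σ => (hx σ).symm
    -- The transverse part of `p` has size `b/r`, so `p` has the same limit as the radial unit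
    -- vector.
    have h3 : Tendsto (fun σ => (b * ‖X σ‖⁻¹) • transverseUnit X p b σ) atTop (𝓝 0) := by
      rw [tendsto_zero_iff_norm_tendsto_zero]
      have := ((tendsto_inv_atTop_zero.comp hXt).const_mul b).norm
      rw [mul_zero, norm_zero] at this
      refine this.congr fun σ => ?_
      rw [norm_smul, h.norm_transverseUnit hb hinv, mul_one]
      rfl
    have h4 := h3.add (ht'.smul h2)
    rw [one_smul, zero_add] at h4
    exact h4.congr fun σ => (h.momentum_eq hb σ).symm

end IsOpticalRay

end Optics

/-! ### Impact parameter, incoming asymptote and polar angle -/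

/-- Lagrange's identity, which identifies the impact parameter with Bouguer's invariant. -/
theorem impactParameter_sq (g : MetricField) (x l : Spacetime) :
    impactParameter g x l ^ 2
      = ‖x.2‖ ^ 2 * ‖-directionTriple g x l‖ ^ 2 - ⟪x.2, -directionTriple g x l⟫ ^ 2 := by
  rw [impactParameter, angularMomentum, norm_neg, inner_neg_right]
  generalize directionTriple g x l = d
  simp only [EuclideanSpace.real_norm_sq_eq, Fin.sum_univ_three, cross_apply, PiLp.inner_apply]
  simp
  ring

theorem ComesFromInfinity.tendsto_norm {x : ℝ → Spacetime} {N : Triple} (hN : ‖N‖ = 1)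
    (h : ComesFromInfinity x N) : Tendsto (fun σ => ‖(x σ).2‖) atBot atTop := by
  refine tendsto_atTop_mono (fun σ => ?_) (tendsto_neg_atBot_atTop.comp h.1)
  have := abs_real_inner_le_norm N (x σ).2
  rw [hN, one_mul] at this
  exact (neg_le_abs _).trans this

theorem ComesFromInfinity.tendsto_radialUnit {x : ℝ → Spacetime} {N : Triple} (hN : ‖N‖ = 1)
    (h : ComesFromInfinity x N) :
    Tendsto (radialUnit fun σ => (x σ).2) atBot (𝓝 (-N)) := by
  obtain ⟨h1, y, hy⟩ := h
  set t : ℝ → ℝ := fun σ => ⟪N, (x σ).2⟫ with ht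
  have hneg : ∀ᶠ σ in atBot, t σ < 0 := h1.eventually_lt_atBot 0
  have h2 : Tendsto (fun σ => (t σ)⁻¹ • (x σ).2) atBot (𝓝 N) := by
    have := ((tendsto_inv_atBot_zero.comp h1).smul hy).add_const N
    rw [zero_smul, zero_add] at this
    refine this.congr' (hneg.mono fun σ hσ => ?_)
    have : t σ ≠ 0 := hσ.ne
    change (t σ)⁻¹ • ((x σ).2 - t σ • N) + N = _
    rw [smul_sub, smul_smul, inv_mul_cancel₀ this, one_smul, sub_add_cancel]
  have h3 : Tendsto (fun σ => -(‖(t σ)⁻¹ • (x σ).2‖⁻¹ • (t σ)⁻¹ • (x σ).2)) atBot (𝓝 (-N)) := by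
    have := ((h2.norm.inv₀ (by rw [hN]; exact one_ne_zero)).smul h2).neg
    -- The sign appears because `⟪N, x⟫` is negative near `-∞`: the ray starts on the side opposite
    -- to `N`.
    rwa [hN, inv_one, one_smul] at this
  refine h3.congr' (hneg.mono fun σ hσ => ?_)
  have : t σ ≠ 0 := hσ.ne
  simp only [radialUnit]
  rw [norm_smul, norm_inv, Real.norm_eq_abs, abs_of_neg hσ, smul_smul, ← neg_smul]
  congr 1
  field_simp

/-- The polar angle of a ray whose bending is governed by `Q`, and its expansion. -/
theorem exists_polarAngle {Q : ℝ → ℝ} {v₀ δ C a k : ℝ} (hQ : ContinuousOn Q (Metric.ball 0 v₀))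
    (hQ1 : ∀ v, |v| < v₀ → |Q v| ≤ 1)
    (hQ3 : ∀ v, |v| < v₀ → |Q v - (a * v + 2 * k * v ^ 2)| ≤ C * |v| ^ 3) (hC : 0 < C)
    (hδ : 0 < δ) (hδ' : δ < v₀) :
    ∃ J : ℝ → ℝ, Continuous J ∧ J 0 = 0 ∧ (∀ t, J (-t) = -J t) ∧
      (∀ t, HasDerivAt J (1 + Q (δ * Real.cos t)) t) ∧ 0 ≤ J (Real.pi / 2) ∧
      J (Real.pi / 2) ≤ Real.pi ∧
      |2 * J (Real.pi / 2) - Real.pi - (2 * a * δ + k * Real.pi * δ ^ 2)|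
        ≤ C * Real.pi * δ ^ 3 := by
  have hmem : ∀ t, |δ * Real.cos t| ≤ δ := fun t => by
    rw [abs_mul, abs_of_pos hδ]
    exact mul_le_of_le_one_right hδ.le (Real.abs_cos_le_one t)
  have hQc : Continuous fun t => Q (δ * Real.cos t) :=
    hQ.comp_continuous (by fun_prop) fun t => by
      simpa using (hmem t).trans_lt hδ'
  have hpi := Real.pi_pos
  have hd : ∀ t, HasDerivAt (fun t => ∫ s in (0 : ℝ)..t, (1 + Q (δ * Real.cos s)))
      (1 + Q (δ * Real.cos t)) t := fun t =>
    ((continuous_const.add hQc).integral_hasStrictDerivAt 0 t).hasDerivAt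
  have hsplit : ∫ s in (0 : ℝ)..Real.pi / 2, (1 + Q (δ * Real.cos s))
      = Real.pi / 2 + ∫ s in (0 : ℝ)..Real.pi / 2, Q (δ * Real.cos s) := by
    rw [intervalIntegral.integral_add (by simp) (hQc.intervalIntegrable _ _)]
    simp
  -- This crude bound places `J (π / 2)` in `[0, π]`, where it can be recovered as an angle from its
  -- cosine.
  have hbd : |∫ s in (0 : ℝ)..Real.pi / 2, Q (δ * Real.cos s)| ≤ 1 * |Real.pi / 2 - 0| := by
    rw [← Real.norm_eq_abs]
    exact intervalIntegral.norm_integral_le_of_norm_le_const fun s _ =>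
      by simpa using hQ1 _ ((hmem s).trans_lt hδ')
  rw [sub_zero, abs_of_pos (show 0 < Real.pi / 2 by positivity), one_mul] at hbd
  obtain ⟨hb1, hb2⟩ := abs_le.1 hbd
  refine ⟨fun t => ∫ s in (0 : ℝ)..t, (1 + Q (δ * Real.cos s)),
    continuous_iff_continuousAt.2 fun t => (hd t).continuousAt, by simp, fun t => ?_, hd,
    ?_, ?_, ?_⟩
  · have := intervalIntegral.integral_comp_neg (a := 0) (b := t)
      (f := fun s => 1 + Q (δ * Real.cos s))
    simp only [Real.cos_neg, neg_zero] at this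
    simp only [this]
    rw [intervalIntegral.integral_symm]
  · simp only [hsplit]
    linarith
  · simp only [hsplit]
    linarith
  · simp only [hsplit]
    have hpoly : ∫ s in (0 : ℝ)..Real.pi / 2, (a * (δ * Real.cos s) + 2 * k * (δ * Real.cos s) ^ 2)
        = a * δ + k * Real.pi * δ ^ 2 / 2 := by
      have e : ∀ s, a * (δ * Real.cos s) + 2 * k * (δ * Real.cos s) ^ 2
          = (a * δ) * Real.cos s + (2 * k * δ ^ 2) * Real.cos s ^ 2 := fun s => by ring
      simp only [e]
      rw [intervalIntegral.integral_add (Continuous.intervalIntegrable (by fun_prop) _ _)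
        (Continuous.intervalIntegrable (by fun_prop) _ _),
        intervalIntegral.integral_const_mul, intervalIntegral.integral_const_mul, integral_cos,
        integral_cos_sq]
      simp
      ring
    have hbd' : |∫ s in (0 : ℝ)..Real.pi / 2, (Q (δ * Real.cos s)
        - (a * (δ * Real.cos s) + 2 * k * (δ * Real.cos s) ^ 2))| ≤ C * δ ^ 3 * |Real.pi / 2 - 0| := by
      rw [← Real.norm_eq_abs]
      refine intervalIntegral.norm_integral_le_of_norm_le_const fun s _ => ?_
      rw [Real.norm_eq_abs]
      exact (hQ3 _ ((hmem s).trans_lt hδ')).trans (by gcongr; exact hmem s)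
    rw [intervalIntegral.integral_sub (hQc.intervalIntegrable _ _)
      (Continuous.intervalIntegrable (by fun_prop) _ _), hpoly, sub_zero,
      abs_of_pos (show 0 < Real.pi / 2 by positivity)] at hbd'
    rw [abs_le] at hbd' ⊢
    constructor <;> linarith [hbd'.1, hbd'.2]

/-! ### Observed and Euclidean angles -/

namespace Potentials

variable {β γ ε : ℝ} (P : Potentials β γ ε)

/-- Rays which are orthogonal in the chart are seen orthogonal by a static observer. -/
theorem observedAngle_of_inner_eq_zero {m : ℝ} {y l l' : Spacetime}
    (hA : 0 < seriesSum P.a (m / ‖y.2‖)) (hl : 0 < l.1) (h : ⟪l.2, l'.2⟫ = 0) :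
    observedAngle (P.metric m) y l l' = Real.pi / 2 := by
  have hA' := hA.ne'
  have hs : √(seriesSum P.a (m / ‖y.2‖)) ^ 2 = seriesSum P.a (m / ‖y.2‖) := Real.sq_sqrt hA.le
  have hs0 : √(seriesSum P.a (m / ‖y.2‖)) ≠ 0 := (Real.sqrt_pos.2 hA).ne'
  have h1 : (observedDirection (P.metric m) y l).1 = 0 := by
    simp only [observedDirection, staticVelocity, metric_apply, Prod.fst_sub, Prod.smul_fst,
      Prod.smul_snd, smul_zero, inner_zero_left, mul_zero, sub_zero, mul_one, smul_eq_mul]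
    field_simp
    rw [hs]
    ring
  have h2 : ∀ l, ∃ k : ℝ, (observedDirection (P.metric m) y l).2 = k • l.2 := fun l =>
    ⟨1 / P.metric m y (staticVelocity (P.metric m) y) l, by
      simp [observedDirection, staticVelocity]⟩
  obtain ⟨k, hk⟩ := h2 l
  obtain ⟨k', hk'⟩ := h2 l'
  rw [observedAngle, metric_apply, h1, hk, hk', inner_smul_left, inner_smul_right, h]
  simp

end Potentials

section Angles

variable {V : Type*} [NormedAddCommGroup V] [InnerProductSpace ℝ V] {e₁ e₂ : V} {φ : ℝ}

theorem norm_cos_smul_add_sin_smul (h₁ : ‖e₁‖ = 1) (h₂ : ‖e₂‖ = 1) (h : ⟪e₁, e₂⟫ = 0) :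
    ‖Real.cos φ • e₁ + Real.sin φ • e₂‖ = 1 := by
  have : ‖Real.cos φ • e₁ + Real.sin φ • e₂‖ ^ 2 = 1 := by
    rw [norm_add_sq_real, norm_smul, norm_smul, inner_smul_left, inner_smul_right, h, h₁, h₂]
    simp
  nlinarith [norm_nonneg (Real.cos φ • e₁ + Real.sin φ • e₂)]

theorem norm_sin_smul_sub_cos_smul (h₁ : ‖e₁‖ = 1) (h₂ : ‖e₂‖ = 1) (h : ⟪e₁, e₂⟫ = 0) :
    ‖Real.sin φ • e₂ - Real.cos φ • e₁‖ = 1 := by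
  have : ‖Real.sin φ • e₂ - Real.cos φ • e₁‖ ^ 2 = 1 := by
    rw [norm_sub_sq_real, norm_smul, norm_smul, inner_smul_left, inner_smul_right,
      real_inner_comm, h, h₁, h₂]
    simp
  nlinarith [norm_nonneg (Real.sin φ • e₂ - Real.cos φ • e₁)]

theorem angle_sin_smul_sub_cos_smul_neg (h₁ : ‖e₁‖ = 1) (h₂ : ‖e₂‖ = 1) (h : ⟪e₁, e₂⟫ = 0)
    (h0 : 0 ≤ φ) (hpi : φ ≤ Real.pi) :
    InnerProductGeometry.angle (Real.sin φ • e₂ - Real.cos φ • e₁) (-e₁) = φ := by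
  rw [InnerProductGeometry.angle, norm_sin_smul_sub_cos_smul h₁ h₂ h, norm_neg, h₁,
    inner_neg_right, inner_sub_left, inner_smul_left, inner_smul_left, real_inner_comm, h,
    real_inner_self_eq_norm_sq, h₁]
  simp [Real.arccos_cos h0 hpi]

/-- The inner product is `sin² φ - cos² φ = cos (2φ - π)`, and `|2φ - π|` lies in `[0, π]`. -/
theorem angle_asymptotes (h₁ : ‖e₁‖ = 1) (h₂ : ‖e₂‖ = 1) (h : ⟪e₁, e₂⟫ = 0)
    (h0 : 0 ≤ φ) (hpi : φ ≤ Real.pi) :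
    InnerProductGeometry.angle (Real.sin φ • e₂ - Real.cos φ • e₁)
      (Real.cos φ • e₁ + Real.sin φ • e₂) = |2 * φ - Real.pi| := by
  rw [InnerProductGeometry.angle, norm_sin_smul_sub_cos_smul h₁ h₂ h,
    norm_cos_smul_add_sin_smul h₁ h₂ h]
  have e : ⟪Real.sin φ • e₂ - Real.cos φ • e₁, Real.cos φ • e₁ + Real.sin φ • e₂⟫
      = Real.cos |2 * φ - Real.pi| := by
    rw [Real.cos_abs, Real.cos_sub_pi, Real.cos_two_mul]
    simp only [inner_sub_left, inner_add_right, inner_smul_left, inner_smul_right,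
      real_inner_self_eq_norm_sq, h, real_inner_comm e₁ e₂, h₁, h₂, conj_trivial]
    linear_combination Real.sin_sq_add_cos_sq φ
  rw [e, mul_one, div_one, Real.arccos_cos (abs_nonneg _)]
  exact abs_le.2 ⟨by linarith, by linarith⟩

end Angles

/-! ### Distance from the centre and the total deflection -/

theorem IsLightRayOn.continuous_snd {g : MetricField} {x : ℝ → Spacetime}
    (hx : IsLightRayOn g x univ) : Continuous fun σ => (x σ).2 :=
  _root_.continuous_snd.comp (continuousOn_univ.1 hx.differentiable.continuousOn)

/-- A ray with a large impact parameter which reaches infinity stays away from the horizon. -/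
theorem div_norm_le_of_index_lt {X p : ℝ → Triple} {n : ℝ → ℝ} {m b u₀ : ℝ} (hm : 0 < m)
    (hu₀ : 0 < u₀) (hb : 0 < b) (hX : Continuous X)
    (hXt : Tendsto (fun σ => ‖X σ‖) atTop atTop) (hpos : ∀ σ, 0 < ‖X σ‖)
    (hp : ∀ σ, ‖p σ‖ = n (m / ‖X σ‖))
    (hinv : ∀ σ, ‖X σ‖ ^ 2 * ‖p σ‖ ^ 2 - ⟪X σ, p σ⟫ ^ 2 = b ^ 2)
    (hlt : m * (n u₀ / u₀) < b) (σ : ℝ) : m / ‖X σ‖ ≤ u₀ := by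
  by_contra! hσ
  have hlt' : ‖X σ‖ ≤ m / u₀ := by
    rw [lt_div_iff₀ (hpos σ)] at hσ
    rw [le_div_iff₀ hu₀]
    linarith
  obtain ⟨τ', hτ'⟩ := (hXt.eventually_ge_atTop (m / u₀)).exists
  obtain ⟨τ, hτ⟩ := mem_range_of_exists_le_of_exists_ge hX.norm ⟨σ, hlt'⟩ ⟨τ', hτ'⟩
  simp only at hτ
  have h1 := hinv τ
  have e : m / (m / u₀) = u₀ := by field_simp
  have hn : 0 ≤ n u₀ := by
    have := hp τ
    simp only [hτ, e] at this
    exact this ▸ norm_nonneg _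
  rw [hp τ, hτ, e] at h1
  have h2 : b ^ 2 ≤ (m * (n u₀ / u₀)) ^ 2 := by
    have : (m * (n u₀ / u₀)) ^ 2 = (m / u₀) ^ 2 * n u₀ ^ 2 := by ring
    rw [this]
    nlinarith [sq_nonneg ⟪X τ, p τ⟫]
  exact absurd ((sq_le_sq₀ hb.le (by positivity)).1 h2) (not_le.2 hlt)

theorem cos_arctan_div {s b r n : ℝ} (hb : 0 < b) (hr : 0 < r) (hn : 0 < n)
    (h : r ^ 2 * n ^ 2 - s ^ 2 = b ^ 2) : Real.cos (Real.arctan (s / b)) = b / (r * n) := by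
  have : 1 + (s / b) ^ 2 = (r * n / b) ^ 2 := by
    field_simp
    linear_combination -h
  rw [Real.cos_arctan, this, Real.sqrt_sq (by positivity), one_div_div]

theorem Potentials.exists_total_deflection {β γ ε : ℝ} (P : Potentials β γ ε) :
    ∃ K C : ℝ, 0 < K ∧ 0 < C ∧ ∀ m : ℝ, 0 < m → ∀ x : ℝ → Spacetime,
      IsLightRayOn (P.metric m) x univ → (∀ σ, P.rh m < ‖(x σ).2‖) →
      Tendsto (fun σ => ‖(x σ).2‖) atTop atTop →
      ∀ (σP : ℝ) (Ne : Triple), (∀ σ, ‖(x σP).2‖ ≤ ‖(x σ).2‖) → ‖Ne‖ = 1 →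
      ComesFromInfinity x Ne →
      ∀ σ₀ b : ℝ, b = impactParameter (P.metric m) (x σ₀) (deriv x σ₀) → K * P.rh m ≤ b →
      ∃ (φ : ℝ) (e₂ : Triple), 0 ≤ φ ∧ φ ≤ Real.pi ∧
        |2 * φ - Real.pi - (2 * (1 + γ) * (m / b) + kappa β γ ε * Real.pi * (m / b) ^ 2)|
          ≤ C * (m / b) ^ 3 ∧
        ⟪(x σP).2, (deriv x σP).2⟫ = 0 ∧ ‖e₂‖ = 1 ∧ ⟪‖(x σP).2‖⁻¹ • (x σP).2, e₂⟫ = 0 ∧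
        Ne = Real.sin φ • e₂ - Real.cos φ • ‖(x σP).2‖⁻¹ • (x σP).2 ∧
        Tendsto (fun σ => -directionTriple (P.metric m) (x σ) (deriv x σ)) atTop
          (𝓝 (Real.cos φ • ‖(x σP).2‖⁻¹ • (x σP).2 + Real.sin φ • e₂)) := by
  obtain ⟨u₀, v₀, C, Q, hu₀, hu₀', hv₀, hC, hQc, hQ1, hQ3, hQ⟩ := P.exists_bending
  have hidx : 0 ≤ P.index u₀ := Real.sqrt_nonneg _
  have hh := P.h_pos
  -- In `K`, the first summand gives `m/b < v₀`, the domain of `Q`; the second keeps the ray in `m/r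
  -- ≤ u₀`; the `1` makes the inequality for `v₀` strict. Dividing by `h` converts `m` into `r_h`.
  refine ⟨(1 / v₀ + P.index u₀ / u₀ + 1) / P.h, C * Real.pi, by positivity, by positivity, ?_⟩
  intro m hm x hx hr hXt σP Ne hmin hNe hinf σ₀ b hbdef hKb
  have hKb' : m * (1 / v₀ + P.index u₀ / u₀ + 1) ≤ b := by
    refine le_of_eq_of_le ?_ hKb
    rw [Potentials.rh]
    field_simp
  have hb : 0 < b := lt_of_lt_of_le (by positivity) hKb'
  have hb1 : m * (P.index u₀ / u₀) < b := by
    refine lt_of_lt_of_le (mul_lt_mul_of_pos_left ?_ hm) hKb'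
    have : 0 < 1 / v₀ := by positivity
    linarith
  have hδ : m / b < v₀ := by
    have h1 : m * (1 / v₀) < b := by
      refine lt_of_lt_of_le (mul_lt_mul_of_pos_left ?_ hm) hKb'
      have : 0 ≤ P.index u₀ / u₀ := by positivity
      linarith
    rw [mul_one_div, div_lt_iff₀ hv₀] at h1
    rw [div_lt_iff₀ hb]
    linarith
  obtain ⟨lam, hlam⟩ := P.exists_optical hm hx hr
  set X : ℝ → Triple := fun σ => (x σ).2 with hXdef
  set p : ℝ → Triple := fun σ => -directionTriple (P.metric m) (x σ) (deriv x σ) with hpdef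
  set q : ℝ → ℝ := fun σ => P.logSlope (m / ‖X σ‖) with hqdef
  have hpos : ∀ σ, 0 < ‖X σ‖ := fun σ => (mul_pos hh hm).trans (hr σ)
  have hopt : IsOpticalRay X p lam q :=
    ⟨fun σ => (hlam σ).1, fun σ => norm_pos_iff.1 (hpos σ), fun σ => (hlam σ).2.2.1,
      fun σ => (hlam σ).2.2.2.1⟩
  have hpn : ∀ σ, ‖p σ‖ = P.index (m / ‖X σ‖) := fun σ => (hlam σ).2.2.2.2
  have hinv : ∀ σ, ‖X σ‖ ^ 2 * ‖p σ‖ ^ 2 - ⟪X σ, p σ⟫ ^ 2 = b ^ 2 := fun σ => by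
    rw [hbdef, impactParameter_sq]
    exact hopt.invariant σ σ₀
  have hu : ∀ σ, m / ‖X σ‖ ≤ u₀ :=
    div_norm_le_of_index_lt hm hu₀ hb hx.continuous_snd hXt hpos hpn hinv hb1
  have hpp : ∀ σ, 0 < ‖p σ‖ := fun σ => by
    have h1 : 0 < m / ‖X σ‖ := div_pos hm (hpos σ)
    have h2 := (hu σ).trans_lt hu₀'
    rw [hpn]
    exact Real.sqrt_pos.2 (mul_pos (P.d_pos _ h1 h2) (inv_pos.2 (P.a_pos _ h1 h2)))
  have hq : ∀ σ, q σ < 1 := fun σ => (hQ _ (div_pos hm (hpos σ)) (hu σ)).1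
  obtain ⟨J, hJc, hJ0, hJodd, hJd, hJnn, hJpi, hJest⟩ :=
    exists_polarAngle hQc hQ1 hQ3 hC (div_pos hm hb) hδ
  have hJ : ∀ σ, HasDerivAt J (1 - q σ)⁻¹ (Real.arctan (⟪X σ, p σ⟫ / b)) := fun σ => by
    refine (hJd _).congr_deriv ?_
    have hrσ := (hpos σ).ne'
    -- The argument of `Q` along the ray is `(m/b) cos ψ = m/(r n)`, where `Q` is known to equal
    -- `q/(1 - q)`; hence `1 + Q = 1/(1 - q)`.
    have e : m / b * Real.cos (Real.arctan (⟪X σ, p σ⟫ / b))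
        = m / ‖X σ‖ * (P.index (m / ‖X σ‖))⁻¹ := by
      rw [cos_arctan_div hb (hpos σ) (hpp σ) (hinv σ), ← hpn]
      have := (hpp σ).ne'
      field_simp
    rw [e, (hQ _ (div_pos hm (hpos σ)) (hu σ)).2]
    change 1 + q σ * (1 + -1 * q σ)⁻¹ = _
    have h1 : 1 - q σ ≠ 0 := (sub_pos.2 (hq σ)).ne'
    have h2 : 1 + -1 * q σ = 1 - q σ := by ring
    rw [h2]
    field_simp
    ring
  have hP : ⟪X σP, p σP⟫ = 0 := by
    have hm0 : IsLocalMin (fun σ => ‖X σ‖) σP := Eventually.of_forall hmin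
    have := hm0.hasDerivAt_eq_zero (hopt.hasDerivAt_norm σP)
    have h1 := (hopt.lam_pos σP).ne'
    have h2 := (hpos σP).ne'
    field_simp at this
    simpa [h1] using this
  have hXb : Tendsto (fun σ => ‖X σ‖) atBot atTop := hinf.tendsto_norm hNe
  have hpl : ∀ l : Filter ℝ, Tendsto (fun σ => ‖X σ‖) l atTop →
      Tendsto (fun σ => ‖p σ‖) l (𝓝 1) := fun l hl =>
    (P.hasJet_index.tendsto.comp (hl.const_div_atTop m)).congr fun σ => (hpn σ).symm
  obtain ⟨e₂, he₂, hor, hlimb, hlimt⟩ := hopt.exists_asymptotes hb hinv hq hJ hJ0 hJodd hJc hP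
    hXt hXb (hpl _ hXt) (hpl _ hXb)
  refine ⟨J (Real.pi / 2), e₂, hJnn, hJpi, hJest, ?_, he₂, hor, ?_, hlimt⟩
  · rw [(hlam σP).2.1, inner_smul_right]
    exact mul_eq_zero_of_right _ hP
  -- The backward limit of the radial direction is `-Ne` by the asymptote and is also known in the
  -- periapsis frame.
  · have := tendsto_nhds_unique (hinf.tendsto_radialUnit hNe) hlimb
    rw [← neg_neg Ne, this, neg_sub]
    rfl

end PPM
end

/-! ### The deflection formula -/

theorem proposition9 (β γ ε : ℝ) (P : Potentials β γ ε) :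
    ∃ K C : ℝ, 0 < K ∧ 0 < C ∧
      ∀ c M G : ℝ, 0 < c → 0 < M → 0 < G →
      ∀ m : ℝ, m = G * M / c ^ 2 →
      -- the whole ray, in the exterior region, returning to infinity
      ∀ x : ℝ → Spacetime,
        IsLightRayOn (P.metric m) x univ →
        (∀ σ, P.rh m < ‖(x σ).2‖) →
        Tendsto (fun σ => ‖(x σ).2‖) atTop atTop →
      -- its periapsis, the portion up to it being quasi-Minkowskian
      ∀ (σP : ℝ) (Ne : Triple),
        (∀ σ, ‖(x σP).2‖ ≤ ‖(x σ).2‖) →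
        IsQuasiMinkowskianFromInfinity P c M G Ne σP x →
      -- its impact parameter, evaluated at any of its points
      ∀ σ₀ b : ℝ, b = impactParameter (P.metric m) (x σ₀) (deriv x σ₀) →
        K * P.rh m ≤ b →
      -- the ingoing radial null geodesic arriving at the periapsis at the same instant
      ∀ (y : ℝ → Spacetime) (τ : ℝ) (nP : Triple),
        IsIngoingRadialRay (P.metric m) (P.rh m) nP τ y →
        y τ = x σP →
      -- the total deflection
      ∀ Δχ : ℝ,
        Δχ = 2 * deflectionAt (P.metric m) (x σP) (deriv x σP) (derivWithin y (Iic τ) τ) Ne nP →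
        |Δχ - (2 * (1 + γ) * G * M / (c ^ 2 * b)
            + kappa β γ ε * Real.pi * G ^ 2 * M ^ 2 / (c ^ 4 * b ^ 2))|
          ≤ C * (G ^ 3 * M ^ 3 / (c ^ 6 * b ^ 3)) ∧
        ∃ No : Triple,
          Tendsto (fun σ => -directionTriple (P.metric m) (x σ) (deriv x σ)) atTop (𝓝 No) ∧
          InnerProductGeometry.angle Ne No = |Δχ| := by
  obtain ⟨K, C, hK, hC, hmain⟩ := P.exists_total_deflection
  refine ⟨K, C, hK, hC, ?_⟩
  intro c M G hc hM hG m hm x hx hr hXt σP Ne hmin hqm σ₀ b hbdef hKb y τ nP hy hyx Δχ hΔ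
  have hm0 : 0 < m := by rw [hm]; positivity
  have hrh : 0 < P.rh m := mul_pos P.h_pos hm0
  obtain ⟨hNe, Xs, z, -, hzx, hz⟩ := hqm
  -- The family taken at `G' = G` coincides with `x` up to the periapsis, so `x` inherits its
  -- asymptote.
  have hinf : ComesFromInfinity x Ne := by
    obtain ⟨h1, w, h2⟩ := (hz G hG le_rfl).2.2.2
    refine ⟨h1.congr' ?_, w, h2.congr' ?_⟩ <;>
    · filter_upwards [eventually_le_atBot σP] with σ hσ
      rw [hzx σ hσ]
  obtain ⟨φ, e₂, hφ0, hφpi, hest, hperp, he₂, hor, hNeq, hlim⟩ :=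
    hmain m hm0 x hx hr hXt σP Ne hmin hNe hinf σ₀ b hbdef hKb
  have hpos : 0 < ‖(x σP).2‖ := hrh.trans (hr σP)
  have hb : 0 < b := lt_of_lt_of_le (mul_pos hK hrh) hKb
  have hnP : ‖(x σP).2‖⁻¹ • (x σP).2 = nP := by
    have := hy.radial τ le_rfl
    rw [hyx] at this
    rw [inv_smul_eq_iff₀ hpos.ne']
    exact this
  rw [hnP] at hor hNeq hlim
  have hortho : inner ℝ (deriv x σP).2 (derivWithin y (Iic τ) τ).2 = 0 := by
    obtain ⟨k, -, hk⟩ := hy.ingoing τ le_rfl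
    rw [hk, ← hnP, inner_neg_right, inner_smul_right, inner_smul_right, real_inner_comm, hperp]
    simp
  have hA : 0 < seriesSum P.a (m / ‖(x σP).2‖) := by
    refine P.a_pos _ (div_pos hm0 hpos) ?_
    rw [div_lt_div_iff₀ hpos P.h_pos, one_mul, mul_comm]
    exact hr σP
  have hfut : 0 < (deriv x σP).1 := by
    have := hx.future σP (mem_univ _)
    rwa [derivWithin_univ] at this
  -- The observed angle is `π/2` and the Euclidean one is `φ`, so the deflection at the periapsis is
  -- `φ - π/2`.
  have hΔ' : Δχ = 2 * φ - Real.pi := by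
    rw [hΔ, deflectionAt, gravSeparation, P.observedAngle_of_inner_eq_zero hA hfut hortho, hNeq,
      angle_sin_smul_sub_cos_smul_neg hy.unit he₂ hor hφ0 hφpi]
    ring
  refine ⟨?_, _, hlim, ?_⟩
  · have e1 : 2 * (1 + γ) * G * M / (c ^ 2 * b) + kappa β γ ε * Real.pi * G ^ 2 * M ^ 2
        / (c ^ 4 * b ^ 2) = 2 * (1 + γ) * (m / b) + kappa β γ ε * Real.pi * (m / b) ^ 2 := by
      rw [hm]
      field_simp
    have e2 : G ^ 3 * M ^ 3 / (c ^ 6 * b ^ 3) = (m / b) ^ 3 := by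
      rw [hm]
      field_simp
    rw [e1, e2, hΔ']
    exact hest
  · rw [hNeq, angle_asymptotes hy.unit he₂ hor hφ0 hφpi, hΔ']
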